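/- A turn sequence is a finite word $\sigma=\sigma_1\cdots\sigma_n$ ($n\ge 0$) over $\{\texttt{L},\texttt{R}\}$. A rectilinear chain realizes $\sigma$ if it starts at the origin $o$, has $n+1$ segments of positive integer length, its first segment heads east, its successive $90^\circ$ turns are $\sigma_1,\dots,\sigma_n$ ($\texttt{L}$ for left, $\texttt{R}$ for right), and it is simple (it does not touch or cross itself; in particular it is not closed). Let $A(\sigma)\subseteq\mathbb Z^2$ be the set of the endpoints of all chains that realize $\sigma$. For a point $p=(a,b)\in\mathbb Z^2$ let $$V^+(p)=\{(a+\mathrm{sgn}(a)\,i,\,j): i\in\mathbb Z_{\ge 0},\ j\in\mathbb Z\}\ (a\ne 0),\qquad H^+(p)=\{(i,\,b+\mathrm{sgn}(b)\,j): i\in\mathbb Z,\ j\in\mathbb Z_{\ge 0}\}\ (b\neq 0),$$ and $Q^+(p)=V^+(p)\cap H^+(p)$ $(a,b\ne 0)$. A staircase is a turn sequence in which left and right turns alternate. A hook of $\sigma$ is a pair of consecutive equal turns $\sigma_i=\sigma_{i+1}$; it is a right, left, up or down hook according to the direction (east, west, north, south) of the segment between these two turns. Let $(x^+_\sigma,0)$,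 $(x^-_\sigma,0)$, $(0,y^+_\sigma)$, $(0,y^-_\sigma)$ be the points of $A(\sigma)$ closest to $o$ on the positive $x$-axis, the negative $x$-axis, the positive $y$-axis and the negative $y$-axis (the origin excluded), respectively, if they exist. **Theorem.** For every turn sequence $\sigma$ of length $n\ge 0$, $$A(\sigma)=\begin{cases} \{(a,0): a\in\mathbb Z,\ a\ge 1\} & \text{if } n=0,\\ Q^+\big((1+\lfloor n/2\rfloor,\ \lceil n/2\rceil)\big) & \text{if } n\ge 1,\ \sigma\text{ is a staircase and }\sigma_1=\texttt{L},\\ Q^+\big((1+\lfloor n/2\rfloor,\ -\lceil n/2\rceil)\big) & \text{if } n\ge 1,\ \sigma\text{ is a staircase and }\sigma_1=\texttt{R},\\ \displaystyle\bigcup_{a\in\{x^+_\sigma,x^-_\sigma\}}V^+((a,0))\ \cup\bigcup_{b\in\{y^+_\sigma,y^-_\sigma\}}H^+((0,b)) & \text{otherwise,} \end{cases}$$ where the unions are over those of $x^\pm_\sigma$, $y^\pm_\sigma$ that exist. Moreover, if $n\ge 1$, then $x^+_\sigma$, $x^-_\sigma$, $y^+_\sigma$ and $y^-_\sigma$ exist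 if and only if $\sigma$ has a right, left, up and down hook, respectively. -/

import Mathlib

namespace TurnSeq

/-- A left or a right turn (by 90 degrees). -/
inductive Turn where
  | L
  | R

/-- Turning a heading by 90 degrees: `L` is counterclockwise, `R` is clockwise. -/
def Turn.apply : ℤ × ℤ → Turn → ℤ × ℤ
  | d, Turn.L => (-d.2, d.1)
  | d, Turn.R => (d.2, -d.1)

/-- The heading, after the turns in `u`, of a turtle that initially heads to the east. -/
def heading (u : List Turn) : ℤ × ℤ :=
  u.foldl Turn.apply (1, 0)

/-- The inclusion of the integer grid into the plane. -/
noncomputable def toPlane (p : ℤ × ℤ) : ℝ × ℝ :=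
  ((p.1 : ℝ), (p.2 : ℝ))

/-- The `i`-th segment (a closed segment of the plane) of the chain with vertices
`C 0, C 1, C 2, …`. -/
def seg (C : ℕ → ℤ × ℤ) (i : ℕ) : Set (ℝ × ℝ) :=
  segment ℝ (toPlane (C i)) (toPlane (C (i + 1)))

/-- The chain with the vertices `C 0, …, C (n + 1)`, where `n = σ.length`, realizes `σ`.
(The values `C k` for `k > n + 1` play no role.) -/
structure Realizes (σ : List Turn) (C : ℕ → ℤ × ℤ) : Prop where
  /-- The chain starts from the origin. -/
  start : C 0 = (0, 0)
  /-- Segment `i` has positive integral length, and its direction is the one that results from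
  heading to the east at first and making the first `i` turns of `σ`. -/
  step : ∀ i ≤ σ.length, ∃ l : ℕ, 0 < l ∧ C (i + 1) = C i + (l : ℤ) • heading (σ.take i)
  /-- The chain is simple: two distinct segments meet at most in the vertex that they share if
  they are consecutive. -/
  simple : ∀ i j, i < j → j ≤ σ.length → ∀ x ∈ seg C i ∩ seg C j, j = i + 1 ∧ x = toPlane (C j)

/-- The set `A(σ)` of the points that are reachable by `σ`. -/
def reachable (σ : List Turn) : Set (ℤ × ℤ) :=
  {p | ∃ C : ℕ → ℤ × ℤ, Realizes σ C ∧ C (σ.length + 1) = p}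

/-- The halfplane `V⁺(p)` (used only if the first coordinate of `p` is not zero). -/
def VPlus (p : ℤ × ℤ) : Set (ℤ × ℤ) :=
  {q | ∃ (i : ℕ) (j : ℤ), q = (p.1 + p.1.sign * (i : ℤ), j)}

/-- The halfplane `H⁺(p)` (used only if the second coordinate of `p` is not zero). -/
def HPlus (p : ℤ × ℤ) : Set (ℤ × ℤ) :=
  {q | ∃ (i : ℤ) (j : ℕ), q = (i, p.2 + p.2.sign * (j : ℤ))}

/-- The quadrant `Q⁺(p)`. -/
def QPlus (p : ℤ × ℤ) : Set (ℤ × ℤ) :=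
  VPlus p ∩ HPlus p

/-- A staircase: the turns alternate. -/
def IsStaircase (σ : List Turn) : Prop :=
  σ.IsChain (fun s t => s ≠ t)

/-- `σ` has a hook (two consecutive equal turns) whose middle segment, the one between
the two turns, has direction `d`. -/
def HasHook (σ : List Turn) (d : ℤ × ℤ) : Prop :=
  ∃ (u v : List Turn) (t : Turn), σ = u ++ t :: t :: v ∧ heading (u ++ [t]) = d

def HasRightHook (σ : List Turn) : Prop := HasHook σ (1, 0)
def HasLeftHook (σ : List Turn) : Prop := HasHook σ (-1, 0)
def HasUpHook (σ : List Turn) : Prop := HasHook σ (0, 1)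
def HasDownHook (σ : List Turn) : Prop := HasHook σ (0, -1)

/-- `(a, 0)` is the reachable point closest to the origin on the positive x-axis. -/
def IsXPlus (σ : List Turn) (a : ℤ) : Prop :=
  IsLeast {c : ℤ | 0 < c ∧ (c, 0) ∈ reachable σ} a

/-- `(a, 0)` is the reachable point closest to the origin on the negative x-axis. -/
def IsXMinus (σ : List Turn) (a : ℤ) : Prop :=
  IsGreatest {c : ℤ | c < 0 ∧ (c, 0) ∈ reachable σ} a

/-- `(0, b)` is the reachable point closest to the origin on the positive y-axis. -/
def IsYPlus (σ : List Turn) (b : ℤ) : Prop :=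
  IsLeast {c : ℤ | 0 < c ∧ (0, c) ∈ reachable σ} b

/-- `(0, b)` is the reachable point closest to the origin on the negative y-axis. -/
def IsYMinus (σ : List Turn) (b : ℤ) : Prop :=
  IsGreatest {c : ℤ | c < 0 ∧ (0, c) ∈ reachable σ} b

end TurnSeq

open TurnSeq

/-! A simple rectilinear chain survives every vertical deformation that keeps the signs of its steps
and the strict vertical order of vertices whose segments share a column (`Apart.move_of_column`);
ties may be broken freely. Together with the symmetries (exchange of the axes, reflections,
reversal) this is the main tool. If there is at least one turn, it spreads a reachable axis point to
a half-plane (`Reach.halfplane_of_pos`), and it keeps a point of the same half-axis reachable when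
further segments are appended.

Hooks: let every segment up to the middle one of a right hook run far ahead of all earlier vertices.
The next segment then has a free column and can stop on the x-axis, and the remaining segments are
appended (`exists_reach_of_hook`). Conversely, without right hooks, later crossings of a horizontal
strip lie to the left of earlier ones (`GridChain.lt_of_spans`). For the first and the last vertical
segment this excludes an end on the positive x-axis (`exists_hook_of_reach`).

Projection: if there is a hook, an end (a, b) off the axes can be moved to (a, 0) or to (0, b)
(`Reach.axis`). By symmetry, a and b are positive. If the last segment heads up or right, induction
applies to the chain without it; reversal covers a first segment that heads up or right. Otherwise
both extreme segments head down or left. The end can be lowered to the level of the start unless a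
path of upward steps and horizontal chain edges leads from the start to the end
(`GridChain.reach_of_not_upStep`). Likewise, it can be moved to the column of the start unless there
is such a path of rightward steps and vertical chain edges. The two paths cannot coexist: the first
leaves above the second and could rejoin it at the end only if the last segment headed up
(`GridChain.not_forced`).

A staircase is monotone in both coordinates, so unit steps give its extreme point, and stretching
gives the rest of the quadrant (`reach_staircase_iff`). -/

namespace TurnSeq

/-! ### Chains in integer coordinates and their symmetries -/

/-- The integer `b` lies between `p` and `q`. -/
abbrev Btw (b p q : ℤ) : Prop := (p ≤ b ∧ b ≤ q) ∨ (q ≤ b ∧ b ≤ p)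

/-- The signs of the increments of `z` are prescribed by `w`. -/
def Steps (n : ℕ) (w z : ℕ → ℤ) : Prop :=
  ∀ i ≤ n, (w i = 0 ∧ z (i + 1) = z i) ∨ (w i = 1 ∧ z i < z (i + 1)) ∨
    (w i = -1 ∧ z (i + 1) < z i)

/-- `(u i, v i)`, for `i ≤ n`, are unit vectors that are alternately horizontal and vertical. -/
structure Dirs (n : ℕ) (u v : ℕ → ℤ) : Prop where
  dir : ∀ i ≤ n, (u i = 0 ∧ (v i = 1 ∨ v i = -1)) ∨ (v i = 0 ∧ (u i = 1 ∨ u i = -1))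
  alt : ∀ i < n, (u i = 0 ↔ v (i + 1) = 0)

/-- Nonadjacent segments of the chain with the vertices `(x k, y k)`, `k ≤ n + 1`, are disjoint. -/
def Apart (n : ℕ) (x y : ℕ → ℤ) : Prop :=
  ∀ i j, i + 1 < j → j ≤ n → ∀ a b, Btw a (x i) (x (i + 1)) → Btw b (y i) (y (i + 1)) →
    Btw a (x j) (x (j + 1)) → Btw b (y j) (y (j + 1)) → False

/-- The vertices `(x k, y k)`, `k ≤ n + 1`, form a simple chain with directions `(u i, v i)`. -/
structure GridChain (n : ℕ) (u v x y : ℕ → ℤ) : Prop where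
  stepX : Steps n u x
  stepY : Steps n v y
  apart : Apart n x y

/-- A simple chain with directions `(u i, v i)` leads from the origin to `(a, b)`. -/
def Reach (n : ℕ) (u v : ℕ → ℤ) (a b : ℤ) : Prop :=
  ∃ x y, GridChain n u v x y ∧ x 0 = 0 ∧ y 0 = 0 ∧ x (n + 1) = a ∧ y (n + 1) = b

theorem Dirs.swap {n : ℕ} {u v : ℕ → ℤ} (h : Dirs n u v) : Dirs n v u := by
  refine ⟨fun i hi => (h.dir i hi).symm, fun i hi => ?_⟩
  have h1 := h.dir i hi.le
  have h2 := h.dir (i + 1) hi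
  have h3 := h.alt i hi
  omega

theorem Dirs.mono {n m : ℕ} {u v : ℕ → ℤ} (h : Dirs n u v) (hm : m ≤ n) : Dirs m u v :=
  ⟨fun i hi => h.dir i (hi.trans hm), fun i hi => h.alt i (hi.trans_le hm)⟩

theorem Dirs.neg_left {n : ℕ} {u v : ℕ → ℤ} (h : Dirs n u v) : Dirs n (fun i => -u i) v := by
  refine ⟨fun i hi => ?_, fun i hi => ?_⟩
  · have := h.dir i hi
    omega
  · have := h.alt i hi
    omega

theorem Dirs.rev {n : ℕ} {u v : ℕ → ℤ} (h : Dirs n u v) :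
    Dirs n (fun i => u (n - i)) (fun i => v (n - i)) := by
  refine ⟨fun i _ => h.dir (n - i) (Nat.sub_le _ _), fun i hi => ?_⟩
  have e : n - i = n - (i + 1) + 1 := by omega
  have h1 := h.dir (n - i) (Nat.sub_le _ _)
  have h2 := h.dir (n - (i + 1)) (Nat.sub_le _ _)
  have h3 := h.alt (n - (i + 1)) (by omega)
  rw [← e] at h3
  omega

theorem Apart.swap {n : ℕ} {x y : ℕ → ℤ} (h : Apart n x y) : Apart n y x :=
  fun i j hij hj a b h1 h2 h3 h4 => h i j hij hj b a h2 h1 h4 h3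

theorem GridChain.swap {n : ℕ} {u v x y : ℕ → ℤ} (h : GridChain n u v x y) :
    GridChain n v u y x :=
  ⟨h.stepY, h.stepX, h.apart.swap⟩

theorem Reach.swap {n : ℕ} {u v : ℕ → ℤ} {a b : ℤ} (h : Reach n u v a b) : Reach n v u b a := by
  obtain ⟨x, y, hc, h1, h2, h3, h4⟩ := h
  exact ⟨y, x, hc.swap, h2, h1, h4, h3⟩

theorem Reach.neg_left {n : ℕ} {u v : ℕ → ℤ} {a b : ℤ} (h : Reach n u v a b) :
    Reach n (fun i => -u i) v (-a) b := by
  obtain ⟨x, y, hc, h1, h2, h3, h4⟩ := h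
  refine ⟨fun k => -x k, y, ⟨fun i hi => ?_, hc.stepY, ?_⟩, by simp [h1], h2, by simp [h3], h4⟩
  · have := hc.stepX i hi
    omega
  · intro i j hij hj a b e1 e2 e3 e4
    dsimp only at e1 e3
    exact hc.apart i j hij hj (-a) b (by omega) e2 (by omega) e4

theorem Reach.neg_right {n : ℕ} {u v : ℕ → ℤ} {a b : ℤ} (h : Reach n u v a b) :
    Reach n u (fun i => -v i) a (-b) :=
  h.swap.neg_left.swap

theorem Reach.congr {n : ℕ} {u v u' v' : ℕ → ℤ} {a b : ℤ} (h : Reach n u v a b)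
    (hu : ∀ i ≤ n, u i = u' i) (hv : ∀ i ≤ n, v i = v' i) : Reach n u' v' a b := by
  obtain ⟨x, y, hc, h1⟩ := h
  refine ⟨x, y, ⟨fun i hi => ?_, fun i hi => ?_, hc.apart⟩, h1⟩
  · rw [← hu i hi]
    exact hc.stepX i hi
  · rw [← hv i hi]
    exact hc.stepY i hi

theorem Steps.rev {n : ℕ} {w z : ℕ → ℤ} (h : Steps n w z) (a : ℤ) :
    Steps n (fun i => w (n - i)) (fun k => a - z (n + 1 - k)) := by
  intro i hi
  have e1 : n + 1 - i = n - i + 1 := by omega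
  have e2 : n + 1 - (i + 1) = n - i := by omega
  have := h (n - i) (Nat.sub_le _ _)
  dsimp only
  rw [e1, e2]
  omega

/-- The half-turn that exchanges the two ends, followed by backward traversal, keeps the direction
of each segment; only the order of the segments is reversed. -/
theorem Reach.rev {n : ℕ} {u v : ℕ → ℤ} {a b : ℤ} (h : Reach n u v a b) :
    Reach n (fun i => u (n - i)) (fun i => v (n - i)) a b := by
  obtain ⟨x, y, hc, h1, h2, h3, h4⟩ := h
  refine ⟨_, _, ⟨hc.stepX.rev a, hc.stepY.rev b, ?_⟩, by simp [h3], by simp [h4], by simp [h1],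
    by simp [h2]⟩
  intro i j hij hj p q e1 e2 e3 e4
  have r1 : n + 1 - i = n - i + 1 := by omega
  have r2 : n + 1 - (i + 1) = n - i := by omega
  have r3 : n + 1 - j = n - j + 1 := by omega
  have r4 : n + 1 - (j + 1) = n - j := by omega
  dsimp only at e1 e2 e3 e4
  rw [r1, r2] at e1 e2
  rw [r3, r4] at e3 e4
  exact hc.apart (n - j) (n - i) (by omega) (by omega) (a - p) (b - q) (by omega) (by omega)
    (by omega) (by omega)

theorem Reach.of_rev {n : ℕ} {u v : ℕ → ℤ} {a b : ℤ}
    (h : Reach n (fun i => u (n - i)) (fun i => v (n - i)) a b) : Reach n u v a b :=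
  h.rev.congr (fun i hi => by simp [Nat.sub_sub_self hi]) fun i hi => by
    simp [Nat.sub_sub_self hi]

theorem Reach.of_neg_left {n : ℕ} {u v : ℕ → ℤ} {a b : ℤ}
    (h : Reach n (fun i => -u i) v (-a) b) : Reach n u v a b := by
  simpa using h.neg_left

theorem Reach.of_neg_right {n : ℕ} {u v : ℕ → ℤ} {a b : ℤ}
    (h : Reach n u (fun i => -v i) a (-b)) : Reach n u v a b := by
  simpa using h.neg_right

/-! ### Vertical deformations -/

theorem separated_of_disjoint {p q r s : ℤ} (h : ∀ b, Btw b p q → Btw b r s → False) :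
    max p q < min r s ∨ max r s < min p q := by
  by_contra hc
  exact h (max (min p q) (min r s)) (by omega) (by omega)

/-- A vertical deformation that respects the vertical order of those vertices that belong to
nonadjacent segments with a common column keeps these segments apart. -/
theorem Apart.move_of_column {n : ℕ} {x y y' : ℕ → ℤ} (h : Apart n x y)
    (ho : ∀ i ≤ n, ∀ j ≤ n, ∀ a, Btw a (x i) (x (i + 1)) → Btw a (x j) (x (j + 1)) →
      ∀ k l, (k = i ∨ k = i + 1) → (l = j ∨ l = j + 1) → y k < y l → y' k < y' l) :
    Apart n x y' := by
  intro i j hij hj a b h1 h2 h3 h4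
  -- Both segments meet column `a`, so their height ranges are disjoint; one range is entirely below
  -- the other, and the order hypothesis carries this over to `y'`.
  have key := fun b e1 e2 => h i j hij hj a b h1 e1 h3 e2
  have hsep := separated_of_disjoint key
  have o1 := ho i (by omega) j hj a h1 h3
  have o2 := ho j hj i (by omega) a h3 h1
  have a1 := o1 i j (.inl rfl) (.inl rfl)
  have a2 := o1 i (j + 1) (.inl rfl) (.inr rfl)
  have a3 := o1 (i + 1) j (.inr rfl) (.inl rfl)
  have a4 := o1 (i + 1) (j + 1) (.inr rfl) (.inr rfl)
  have b1 := o2 j i (.inl rfl) (.inl rfl)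
  have b2 := o2 (j + 1) i (.inr rfl) (.inl rfl)
  have b3 := o2 j (i + 1) (.inl rfl) (.inr rfl)
  have b4 := o2 (j + 1) (i + 1) (.inr rfl) (.inr rfl)
  clear key o1 o2 ho h1 h3
  omega

/-- A vertical deformation that respects the vertical order of the vertices keeps nonadjacent
segments apart. -/
theorem Apart.move {n : ℕ} {x y y' : ℕ → ℤ} (h : Apart n x y)
    (ho : ∀ k ≤ n + 1, ∀ l ≤ n + 1, y k < y l → y' k < y' l) : Apart n x y' :=
  h.move_of_column fun i hi j hj _ _ _ k l hk hl =>
    ho k (by omega) l (by omega)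

theorem GridChain.move {n : ℕ} {u v x y y' : ℕ → ℤ} (h : GridChain n u v x y)
    (he : ∀ i ≤ n, v i = 0 → y' (i + 1) = y' i)
    (ho : ∀ k ≤ n + 1, ∀ l ≤ n + 1, y k < y l → y' k < y' l) : GridChain n u v x y' := by
  refine ⟨h.stepX, fun i hi => ?_, h.apart.move ho⟩
  have h1 := h.stepY i hi
  have h2 := he i hi
  have h3 := ho i (by omega) (i + 1) (by omega)
  have h4 := ho (i + 1) (by omega) i (by omega)
  omega

/-- The initial part of a chain. -/
theorem GridChain.mono {n m : ℕ} {u v x y : ℕ → ℤ} (h : GridChain n u v x y) (hm : m ≤ n) :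
    GridChain m u v x y :=
  ⟨fun i hi => h.stepX i (hi.trans hm), fun i hi => h.stepY i (hi.trans hm),
    fun i j hij hj => h.apart i j hij (hj.trans hm)⟩

/-- All vertices above level 0 rise by `c - b`. The start, on level 0, stays, and the end rises from
`b` to `c`. -/
theorem Reach.stretch_right {n : ℕ} {u v : ℕ → ℤ} {a b c : ℤ} (h : Reach n u v a b) (hb : 0 < b)
    (hc : b ≤ c) : Reach n u v a c := by
  obtain ⟨x, y, hC, h1, h2, h3, h4⟩ := h
  refine ⟨x, fun k => if 0 < y k then y k + (c - b) else y k,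
    hC.move (fun i hi hv => ?_) (fun k _ l _ hkl => ?_), h1, ?_, h3, ?_⟩
  · have := hC.stepY i hi
    have e : y (i + 1) = y i := by omega
    simp [e]
  · split_ifs <;> omega
  · simp [h2]
  · simp [h4, hb]

/-- If the last segment is vertical, then it can be shortened. -/
theorem Reach.truncate {n : ℕ} {u v x y : ℕ → ℤ} (h : GridChain n u v x y) (hv : v n = 1)
    (hx : x 0 = 0) (hy : y 0 = 0) {c : ℤ} (h1 : y n < c) (h2 : c ≤ y (n + 1)) :
    Reach n u v (x (n + 1)) c := by
  refine ⟨x, fun k => if k = n + 1 then c else y k, ⟨h.stepX, fun i hi => ?_, ?_⟩, hx, by simp [hy],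
    rfl, by simp⟩
  · have := h.stepY i hi
    rcases eq_or_ne i n with rfl | hne
    · simp
      omega
    · have e : i + 1 ≠ n + 1 := by omega
      have e' : i ≠ n + 1 := by omega
      simp only [if_neg e, if_neg e']
      exact this
  · intro i j hij hj a b e1 e2 e3 e4
    have e : i + 1 ≠ n + 1 := by omega
    have e' : i ≠ n + 1 := by omega
    have e'' : j ≠ n + 1 := by omega
    simp only [if_neg e, if_neg e', if_neg e''] at e2 e4
    refine h.apart i j hij hj a b e1 e2 e3 ?_
    rcases eq_or_ne j n with rfl | hne
    · simp only [if_true] at e4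
      omega
    · rw [if_neg (by omega)] at e4
      exact e4

/-- If a reachable point is on the x-axis, then it can be moved vertically. -/
theorem Reach.of_axis {n : ℕ} {u v : ℕ → ℤ} (hd : Dirs n u v) {a : ℤ} (h : Reach n u v a 0)
    (hn : 1 ≤ n) (j : ℤ) : Reach n u v a j := by
  obtain ⟨x, y, hC, h1, h2, h3, h4⟩ := h
  -- The factor `|j| + 1` pushes all nonzero levels beyond `j`. Only the end of the chain leaves
  -- level 0, together with the last segment if that is horizontal.
  refine ⟨x, fun k => if k = n + 1 ∨ (k = n ∧ v n = 0) then j else (|j| + 1) * y k,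
    hC.move (fun i hi hv => ?_) (fun k hk l hl hkl => ?_), h1, ?_, h3, by simp⟩
  · have := hC.stepY i hi
    have e : y (i + 1) = y i := by omega
    rcases eq_or_ne i n with rfl | hne
    · simp [hv]
    · have h5 : i + 1 ≠ n + 1 := by omega
      have h6 : i ≠ n + 1 := by omega
      have h7 : ¬ (i + 1 = n ∧ v n = 0) := by
        rintro ⟨rfl, h⟩
        have := hd.alt i (by omega)
        have := hd.dir i (by omega)
        omega
      simp [hne, h6, e, h7]
  · have hlast : ∀ k, (k = n + 1 ∨ (k = n ∧ v n = 0)) → y k = 0 := by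
      rintro k (rfl | ⟨rfl, h⟩)
      · exact h4
      · have := hC.stepY k le_rfl
        omega
    have hj := abs_lt.1 (lt_add_one |j|)
    have key : ∀ m : ℤ, 0 < m → j < (|j| + 1) * m := fun m hm => by nlinarith [abs_nonneg j]
    have key' : ∀ m : ℤ, m < 0 → (|j| + 1) * m < j := fun m hm => by nlinarith [abs_nonneg j]
    split_ifs with c1 c2 c2
    · rw [hlast k c1, hlast l c2] at hkl
      omega
    · exact key _ (by rw [hlast k c1] at hkl; exact hkl)
    · exact key' _ (by rw [hlast l c2] at hkl; exact hkl)
    · exact mul_lt_mul_of_pos_left hkl (by positivity)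
  · have : ¬ (0 = n + 1 ∨ (0 = n ∧ v n = 0)) := by omega
    simp only [if_neg this, h2, mul_zero]

/-! ### Appending a segment -/

/-- Extending a chain by a vertical segment and deforming it vertically at the same time. -/
theorem GridChain.append {n : ℕ} {u v x y y' : ℕ → ℤ} (h : GridChain n u v x y)
    (hd : Dirs (n + 1) u v) (hu : u (n + 1) = 0) (hs : Steps (n + 1) v y')
    (ho : ∀ k ≤ n + 2, ∀ l ≤ n + 2, y (min k (n + 1)) < y (min l (n + 1)) → y' k < y' l) :
    GridChain (n + 1) u v (fun k => x (min k (n + 1))) y' := by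
  -- Repeating the last vertex appends a degenerate segment that touches no segment before the last
  -- one. The deformation then opens it up.
  have hA : Apart (n + 1) (fun k => x (min k (n + 1))) (fun k => y (min k (n + 1))) := by
    intro i j hij hj a b e1 e2 e3 e4
    have m1 : min i (n + 1) = i := by omega
    have m2 : min (i + 1) (n + 1) = i + 1 := by omega
    have m3 : min j (n + 1) = j := by omega
    simp only [m1, m2, m3] at e1 e2 e3 e4
    rcases Nat.lt_or_ge j (n + 1) with hlt | hge
    · have m4 : min (j + 1) (n + 1) = j + 1 := by omega
      rw [m4] at e3 e4
      exact h.apart i j hij (by omega) a b e1 e2 e3 e4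
    · have hj' : j = n + 1 := by omega
      subst hj'
      have m4 : min (n + 1 + 1) (n + 1) = n + 1 := by omega
      rw [m4] at e3 e4
      rcases Nat.lt_or_ge (i + 1) n with hlt | hge
      · exact h.apart i n hlt le_rfl a b e1 e2 (by omega) (by omega)
      · have hi : n = i + 1 := by omega
        subst hi
        have s1 := h.stepX i (by omega)
        have s2 := h.stepX (i + 1) le_rfl
        have d1 := hd.dir i (by omega)
        have d2 := hd.dir (i + 1) (by omega)
        have d3 := hd.dir (i + 1 + 1) (by omega)
        have a1 := hd.alt i (by omega)
        have a2 := hd.alt (i + 1) (by omega)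
        omega
  refine ⟨fun i hi => ?_, hs, hA.move ho⟩
  rcases Nat.lt_or_ge i (n + 1) with hlt | hge
  · have m1 : min i (n + 1) = i := by omega
    have m2 : min (i + 1) (n + 1) = i + 1 := by omega
    simp only [m1, m2]
    exact h.stepX i (by omega)
  · have hi' : i = n + 1 := by omega
    subst hi'
    left
    simp [hu]

/-- A reachable point on the x-axis remains reachable if a vertical segment is appended. -/
theorem Reach.append_axis {n : ℕ} {u v : ℕ → ℤ} {a : ℤ} (h : Reach n u v a 0) (hn : 1 ≤ n)
    (hd : Dirs (n + 1) u v) (hu : u (n + 1) = 0) : Reach (n + 1) u v a 0 := by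
  obtain ⟨x, y, hC, h1, h2, h3, h4⟩ := h
  have hv0 : v n = 0 := by
    have := hd.alt n (by omega)
    have := hd.dir n (by omega)
    have := hd.dir (n + 1) (by omega)
    omega
  have hyn : y n = 0 := by
    have := hC.stepY n le_rfl
    omega
  have hv1 : v (n + 1) = 1 ∨ v (n + 1) = -1 := by
    have := hd.dir (n + 1) le_rfl
    omega
  have hvn : v (n - 1) ≠ 0 := by
    have h5 := hd.alt (n - 1) (by omega)
    have h6 := hd.dir (n - 1) (by omega)
    rw [Nat.sub_add_cancel hn] at h5
    omega
  -- Doubling frees the levels 1 and -1. The last horizontal segment moves to the one from which the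
  -- new segment returns to level 0.
  refine ⟨fun k => x (min k (n + 1)),
    fun k => if k = n + 2 then 0 else if k = n ∨ k = n + 1 then -v (n + 1) else 2 * y k,
    hC.append hd hu (fun i hi => ?_) (fun k hk l hl hkl => ?_), ?_, ?_, ?_, by simp⟩
  · rcases Nat.lt_trichotomy i n with hlt | rfl | hgt
    · have h5 := hC.stepY i (by omega)
      rcases Nat.lt_or_ge (i + 1) n with h6 | h6
      · rw [if_neg (by omega), if_neg (by omega), if_neg (by omega), if_neg (by omega)]
        omega
      · have h7 : i + 1 = n := by omega
        rw [if_neg (by omega), if_pos (by omega), if_neg (by omega), if_neg (by omega)]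
        rw [h7] at h5
        have : n - 1 = i := by omega
        rw [this] at hvn
        omega
    · left
      simp [hv0]
    · have : i = n + 1 := by omega
      subst this
      simp
      omega
  · have key : ∀ k ≤ n + 2, (k = n ∨ k = n + 1 ∨ k = n + 2) → y (min k (n + 1)) = 0 := by
      rintro k - (rfl | rfl | rfl)
      · simpa using hyn
      · simpa using h4
      · simpa using h4
    have key' : ∀ k, k ≤ n + 2 → ¬ k = n + 2 → y (min k (n + 1)) = y k := by
      intro k hk hk'
      rw [min_eq_left (by omega)]
    have k1 := key k hk
    have k2 := key l hl
    have k3 := key' k hk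
    have k4 := key' l hl
    split_ifs with c1 c2 c3 c4 c5 c6 c7 c8 <;> omega
  · simpa using h1
  · have e1 : ¬ 0 = n + 2 := by omega
    have e2 : ¬ (0 = n ∨ 0 = n + 1) := by omega
    simp only [if_neg e1, if_neg e2, h2, mul_zero]
  · simpa using h3

/-- A reachable point on the positive y-axis can be moved upwards if a segment that heads
upwards is appended. -/
theorem Reach.append_up {n : ℕ} {u v : ℕ → ℤ} {a b c : ℤ} (h : Reach n u v a b) (hb : 0 ≤ b)
    (hd : Dirs (n + 1) u v) (hv : v (n + 1) = 1) (hc : b < c) : Reach (n + 1) u v a c := by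
  obtain ⟨x, y, hC, h1, h2, h3, h4⟩ := h
  have hu : u (n + 1) = 0 := by
    have := hd.dir (n + 1) le_rfl
    omega
  -- The vertices above `b` make room for the new end `c`; the start is not among them because `0 ≤
  -- b`.
  refine ⟨fun k => x (min k (n + 1)),
    fun k => if k = n + 2 then c else if b < y k then y k + (c - b) else y k,
    hC.append hd hu (fun i hi => ?_) (fun k hk l hl hkl => ?_), ?_, ?_, ?_, by simp⟩
  · rcases Nat.lt_or_ge i (n + 1) with hlt | hge
    · have := hC.stepY i (by omega)
      rw [if_neg (show ¬ i = n + 2 by omega), if_neg (show ¬ i + 1 = n + 2 by omega)]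
      split_ifs <;> omega
    · have : i = n + 1 := by omega
      subst this
      right; left
      simp [hv, h4, hc]
  · have key : ∀ k, k = n + 2 → y (min k (n + 1)) = b := by
      rintro k rfl
      simpa using h4
    have key' : ∀ k, k ≤ n + 2 → ¬ k = n + 2 → y (min k (n + 1)) = y k := by
      intro k hk hk'
      rw [min_eq_left (by omega)]
    have k1 := key k
    have k2 := key l
    have k3 := key' k hk
    have k4 := key' l hl
    split_ifs <;> omega
  · simpa using h1
  · simp [h2, hb]
  · simpa using h3

/-- If a point on the positive y-axis is reachable, then such a point remains reachable if a
vertical segment is appended. -/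
theorem Reach.append_along {n : ℕ} {u v : ℕ → ℤ} {b : ℤ} (h : Reach n u v 0 b) (hb : 0 < b)
    (hd : Dirs (n + 1) u v) (hu : u (n + 1) = 0) : ∃ c, 0 < c ∧ Reach (n + 1) u v 0 c := by
  obtain ⟨x, y, hC, h1, h2, h3, h4⟩ := h
  have hv1 : v (n + 1) = 1 ∨ v (n + 1) = -1 := by
    have := hd.dir (n + 1) le_rfl
    omega
  -- Doubling frees the levels next to `2 * b`, so a unit segment fits in either direction and ends
  -- above level 0.
  refine ⟨2 * b + v (n + 1), by omega, fun k => x (min k (n + 1)),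
    fun k => if k = n + 2 then 2 * b + v (n + 1) else 2 * y k,
    hC.append hd hu (fun i hi => ?_) (fun k hk l hl hkl => ?_), ?_, ?_, ?_, by simp⟩
  · rcases Nat.lt_or_ge i (n + 1) with hlt | hge
    · have := hC.stepY i (by omega)
      rw [if_neg (by omega), if_neg (by omega)]
      omega
    · have : i = n + 1 := by omega
      subst this
      simp [h4]
      omega
  · have key : ∀ k, k = n + 2 → y (min k (n + 1)) = b := by
      rintro k rfl
      simpa using h4
    have key' : ∀ k, k ≤ n + 2 → ¬ k = n + 2 → y (min k (n + 1)) = y k := by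
      intro k hk hk'
      rw [min_eq_left (by omega)]
    have k1 := key k
    have k2 := key l
    have k3 := key' k hk
    have k4 := key' l hl
    split_ifs <;> omega
  · simpa using h1
  · simp [h2]
  · simpa using h3

/-! ### Hooks produce reachable axis points -/

theorem Dirs.alt_left {n : ℕ} {u v : ℕ → ℤ} (h : Dirs n u v) {i : ℕ} (hi : i < n) :
    u i = 0 ↔ u (i + 1) ≠ 0 := by
  have := h.dir (i + 1) hi
  have := h.alt i hi
  omega

theorem Dirs.alt_right {n : ℕ} {u v : ℕ → ℤ} (h : Dirs n u v) {i : ℕ} (hi : i < n) :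
    v i = 0 ↔ v (i + 1) ≠ 0 :=
  h.swap.alt_left hi

theorem Dirs.left_eq_zero {n : ℕ} {u v : ℕ → ℤ} (h : Dirs n u v) {i : ℕ} (hi : i ≤ n)
    (hv : v i ≠ 0) : u i = 0 := by
  have := h.dir i hi
  omega

theorem Dirs.left_ne_zero {n : ℕ} {u v : ℕ → ℤ} (h : Dirs n u v) {i : ℕ} (hi : i ≤ n)
    (hv : v i = 0) : u i ≠ 0 := by
  have := h.dir i hi
  omega

theorem Steps.eq {n : ℕ} {w z : ℕ → ℤ} (h : Steps n w z) {i : ℕ} (hi : i ≤ n) (hw : w i = 0) :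
    z (i + 1) = z i := by
  have := h i hi
  omega

theorem Steps.ne {n : ℕ} {w z : ℕ → ℤ} (h : Steps n w z) {i : ℕ} (hi : i ≤ n) (hw : w i ≠ 0) :
    z (i + 1) ≠ z i := by
  have := h i hi
  omega

/-- The chain is beyond all of its previous vertices in the direction of its last segment. -/
def Far (n : ℕ) (u v x y : ℕ → ℤ) : Prop :=
  ∀ k ≤ n, (u n = 1 → x k < x (n + 1)) ∧ (u n = -1 → x (n + 1) < x k) ∧
    (v n = 1 → y k < y (n + 1)) ∧ (v n = -1 → y (n + 1) < y k)

theorem GridChain.extend {n : ℕ} {u v x y : ℕ → ℤ} (h : GridChain n u v x y) {a b : ℤ}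
    (hx : (u (n + 1) = 0 ∧ a = x (n + 1)) ∨ (u (n + 1) = 1 ∧ x (n + 1) < a) ∨
      (u (n + 1) = -1 ∧ a < x (n + 1)))
    (hy : (v (n + 1) = 0 ∧ b = y (n + 1)) ∨ (v (n + 1) = 1 ∧ y (n + 1) < b) ∨
      (v (n + 1) = -1 ∧ b < y (n + 1)))
    (hap : ∀ i < n, ∀ p q, Btw p (x i) (x (i + 1)) → Btw q (y i) (y (i + 1)) →
      Btw p (x (n + 1)) a → Btw q (y (n + 1)) b → False) :
    GridChain (n + 1) u v (fun k => if k = n + 2 then a else x k)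
      (fun k => if k = n + 2 then b else y k) := by
  refine ⟨fun i hi => ?_, fun i hi => ?_, ?_⟩
  · rcases Nat.lt_or_ge i (n + 1) with hlt | hge
    · rw [if_neg (by omega), if_neg (by omega)]
      exact h.stepX i (by omega)
    · obtain rfl : i = n + 1 := by omega
      rw [if_pos rfl, if_neg (by omega)]
      exact hx
  · rcases Nat.lt_or_ge i (n + 1) with hlt | hge
    · rw [if_neg (by omega), if_neg (by omega)]
      exact h.stepY i (by omega)
    · obtain rfl : i = n + 1 := by omega
      rw [if_pos rfl, if_neg (by omega)]
      exact hy
  · intro i j hij hj p q e1 e2 e3 e4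
    have c1 : ¬ i = n + 2 := by omega
    have c2 : ¬ i + 1 = n + 2 := by omega
    have c3 : ¬ j = n + 2 := by omega
    simp only [if_neg c1, if_neg c2, if_neg c3] at e1 e2 e3 e4
    rcases Nat.lt_or_ge j (n + 1) with hlt | hge
    · have c4 : ¬ j + 1 = n + 2 := by omega
      simp only [if_neg c4] at e3 e4
      exact h.apart i j hij (by omega) p q e1 e2 e3 e4
    · obtain rfl : j = n + 1 := by omega
      simp only [if_true] at e3 e4
      exact hap i (by omega) p q e1 e2 e3 e4

theorem exists_bound (n : ℕ) (z : ℕ → ℤ) : ∃ M, ∀ k ≤ n, -M < z k ∧ z k < M := by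
  induction n with
  | zero => exact ⟨|z 0| + 1, fun k hk => by
      obtain rfl : k = 0 := by omega
      exact abs_lt.1 (lt_add_one _)⟩
  | succ n ih =>
    obtain ⟨M, hM⟩ := ih
    refine ⟨max M (|z (n + 1)| + 1), fun k hk => ?_⟩
    have h1 := abs_lt.1 (lt_add_one |z (n + 1)|)
    rcases Nat.lt_or_ge k (n + 1) with h | h
    · have := hM k (by omega)
      omega
    · obtain rfl : k = n + 1 := by omega
      omega

/-- The new segment is perpendicular to the last one and stays on a line beyond all earlier
vertices, so it may be made arbitrarily long, beyond the bounds `M` and `N`. -/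
theorem GridChain.extend_far {n : ℕ} {u v x y : ℕ → ℤ} (h : GridChain n u v x y)
    (hd : Dirs (n + 1) u v) (hf : Far n u v x y) :
    ∃ x' y', GridChain (n + 1) u v x' y' ∧ (∀ k ≤ n + 1, x' k = x k ∧ y' k = y k) ∧
      Far (n + 1) u v x' y' := by
  obtain ⟨M, hM⟩ := exists_bound (n + 1) x
  obtain ⟨N, hN⟩ := exists_bound (n + 1) y
  have d0 := hd.dir n (by omega)
  have d1 := hd.dir (n + 1) le_rfl
  have d2 := hd.alt n (by omega)
  obtain ⟨a, ha⟩ : ∃ a, (u (n + 1) = 0 ∧ a = x (n + 1)) ∨ (u (n + 1) = 1 ∧ a = M) ∨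
      (u (n + 1) = -1 ∧ a = -M) := by
    rcases d1 with h | ⟨-, h | h⟩
    exacts [⟨_, .inl ⟨h.1, rfl⟩⟩, ⟨_, .inr (.inl ⟨h, rfl⟩)⟩, ⟨_, .inr (.inr ⟨h, rfl⟩)⟩]
  obtain ⟨b, hb⟩ : ∃ b, (v (n + 1) = 0 ∧ b = y (n + 1)) ∨ (v (n + 1) = 1 ∧ b = N) ∨
      (v (n + 1) = -1 ∧ b = -N) := by
    rcases d1 with ⟨-, h | h⟩ | h
    exacts [⟨_, .inr (.inl ⟨h, rfl⟩)⟩, ⟨_, .inr (.inr ⟨h, rfl⟩)⟩, ⟨_, .inl ⟨h.1, rfl⟩⟩]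
  have hxa : (u (n + 1) = 0 ∧ a = x (n + 1)) ∨ (u (n + 1) = 1 ∧ x (n + 1) < a) ∨
      (u (n + 1) = -1 ∧ a < x (n + 1)) := by
    have := hM (n + 1) le_rfl
    clear * - this ha
    omega
  have hyb : (v (n + 1) = 0 ∧ b = y (n + 1)) ∨ (v (n + 1) = 1 ∧ y (n + 1) < b) ∨
      (v (n + 1) = -1 ∧ b < y (n + 1)) := by
    have := hN (n + 1) le_rfl
    clear * - this hb
    omega
  refine ⟨_, _, h.extend hxa hyb ?_, fun k hk => ?_, fun k hk => ?_⟩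
  · intro i hi p q e1 e2 e3 e4
    obtain ⟨f1, f2, f3, f4⟩ := hf i (by omega)
    obtain ⟨g1, g2, g3, g4⟩ := hf (i + 1) (by omega)
    rcases d0 with ⟨hu, hv⟩ | ⟨hv, hu⟩
    · have hv1 : v (n + 1) = 0 := d2.1 hu
      obtain rfl : b = y (n + 1) := by omega
      clear * - hv e2 e4 f3 f4 g3 g4
      rcases hv with hv | hv
      · have f := f3 hv
        have g := g3 hv
        clear f3 f4 g3 g4
        omega
      · have f := f4 hv
        have g := g4 hv
        clear f3 f4 g3 g4
        omega
    · have hu1 : u (n + 1) = 0 := by omega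
      obtain rfl : a = x (n + 1) := by omega
      clear * - hu e1 e3 f1 f2 g1 g2
      rcases hu with hu | hu
      · have f := f1 hu
        have g := g1 hu
        clear f1 f2 g1 g2
        omega
      · have f := f2 hu
        have g := g2 hu
        clear f1 f2 g1 g2
        omega
  · have : ¬ k = n + 2 := by omega
    simp [this]
  · have c1 : ¬ k = n + 2 := by omega
    have m1 := hM k (by omega)
    have m2 := hN k (by omega)
    simp only [if_neg c1, if_true]
    clear * - m1 m2 ha hb
    refine ⟨fun h => ?_, fun h => ?_, fun h => ?_, fun h => ?_⟩ <;> omega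

theorem exists_far {n : ℕ} {u v : ℕ → ℤ} (hd : Dirs n u v) :
    ∃ x y, GridChain n u v x y ∧ x 0 = 0 ∧ y 0 = 0 ∧ Far n u v x y := by
  induction n with
  | zero =>
    have h0 := hd.dir 0 le_rfl
    refine ⟨fun k => if k = 0 then 0 else u 0, fun k => if k = 0 then 0 else v 0,
      ⟨fun i hi => ?_, fun i hi => ?_, fun i j hij hj => by omega⟩, by simp, by simp,
      fun k hk => ?_⟩
    · obtain rfl : i = 0 := by omega
      simp
      omega
    · obtain rfl : i = 0 := by omega
      simp
      omega
    · obtain rfl : k = 0 := by omega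
      simp
      omega
  | succ n ih =>
    obtain ⟨x, y, hC, h1, h2, hf⟩ := ih (hd.mono (by omega))
    obtain ⟨x', y', hC', he, hf'⟩ := hC.extend_far hd hf
    exact ⟨x', y', hC', by rw [(he 0 (by omega)).1, h1], by rw [(he 0 (by omega)).2, h2], hf'⟩

/-- A right hook leads to reachable points on the positive x-axis. -/
theorem exists_reach_of_hook {n : ℕ} {u v : ℕ → ℤ} (hd : Dirs n u v) {i : ℕ} (hi : i + 2 ≤ n)
    (hv : v i = -v (i + 2)) (hu : u (i + 1) = 1) : ∃ a, 0 < a ∧ Reach n u v a 0 := by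
  induction n, hi using Nat.le_induction with
  | base =>
    -- Segment `i` ends beyond the level of the start, on the side given by `v i`; segment `i + 2`
    -- heads back and can stop at level 0. Its column is to the right of all earlier vertices.
    obtain ⟨x, y, hC, h1, h2, hf⟩ := exists_far (hd.mono (show i ≤ i + 2 by omega))
    obtain ⟨x', y', hC', he, hf'⟩ := hC.extend_far (hd.mono (by omega)) hf
    have d0 := hd.dir i (by omega)
    have d1 := hd.dir (i + 1) (by omega)
    have d2 := hd.dir (i + 2) (by omega)
    have a1 := hd.alt i (by omega)
    have a2 := hd.alt (i + 1) (by omega)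
    have s1 := hC'.stepY (i + 1) le_rfl
    have e0 := he 0 (by omega)
    have e1 := he (i + 1) (by omega)
    have f0 := hf 0 (by omega)
    have hx : ∀ k ≤ i + 1, x' k < x' (i + 2) := fun k hk => (hf' k hk).1 hu
    have hv1 : v (i + 1) = 0 := by omega
    have hu2 : u (i + 2) = 0 := d2.resolve_right (fun h => by omega) |>.1
    have hy1 : y' (i + 2) = y (i + 1) := (hC'.stepY.eq le_rfl hv1).trans e1.2
    obtain ⟨-, -, f3, f4⟩ := f0
    refine ⟨x' (i + 2), ?_, _, _, hC'.extend (a := x' (i + 2)) (b := 0) (.inl ⟨hu2, rfl⟩) ?_ ?_,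
      ?_, ?_, ?_, ?_⟩
    · have := hx 0 (by omega)
      omega
    · change (v (i + 2) = 0 ∧ 0 = y' (i + 2)) ∨ (v (i + 2) = 1 ∧ y' (i + 2) < 0) ∨
        (v (i + 2) = -1 ∧ 0 < y' (i + 2))
      omega
    · intro k hk p q c1 c2 c3 c4
      have g1 := hx k (by omega)
      have g2 := hx (k + 1) (by omega)
      change Btw p (x' (i + 2)) _ at c3
      clear * - c1 c3 g1 g2
      omega
    · simp [e0, h1]
    · simp [e0, h2]
    · simp
    · simp
  | succ n hn ih =>
    obtain ⟨a, ha, hr⟩ := ih (hd.mono (by omega))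
    by_cases h0 : u (n + 1) = 0
    · exact ⟨a, ha, hr.append_axis (by omega) hd h0⟩
    · have := hd.dir (n + 1) le_rfl
      obtain ⟨c, hc, hr'⟩ := hr.swap.append_along ha hd.swap (by omega)
      exact ⟨c, hc, hr'.swap⟩

/-! ### Reachable axis points require hooks -/

/-- Segment `i` crosses the strip between the levels `h` and `h + 1`. -/
abbrev Spans (y : ℕ → ℤ) (i : ℕ) (h : ℤ) : Prop :=
  (y i ≤ h ∧ h + 1 ≤ y (i + 1)) ∨ (y (i + 1) ≤ h ∧ h + 1 ≤ y i)

/-- Between the two crossings the chain stays above the strip. The strip is raised to the level of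
the lowest vertex in between; there, pairs of segments with a smaller index difference cross it, and
`ih` compares them. -/
theorem GridChain.lt_of_spans_of_above {n : ℕ} {u v x y : ℕ → ℤ} (hd : Dirs n u v)
    (hC : GridChain n u v x y) {i j : ℕ} {h : ℤ}
    (ih : ∀ i' j' h', i' < j' → j' ≤ n → j' - i' < j - i → v i' ≠ 0 → v j' ≠ 0 →
      Spans y i' h' → Spans y j' h' → x j' < x i')
    (hij : i + 2 < j) (hj : j ≤ n) (hvi : v i ≠ 0) (hvj : v j ≠ 0)
    (hsi : Spans y i h) (hsj : Spans y j h)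
    (hno : ∀ k, i < k → k < j → v k ≠ 0 → ¬ Spans y k h) (hup : h + 1 ≤ y (i + 1)) :
    x j < x i := by
  have hge : ∀ k, i + 1 ≤ k → k ≤ j → h + 1 ≤ y k := by
    intro k hk
    induction k, hk using Nat.le_induction with
    | base => exact fun _ => hup
    | succ k hk ih =>
      intro hkj
      have h1 := ih (by omega)
      have h2 := hno k (by omega) (by omega)
      have h3 := hC.stepY k (by omega)
      omega
  obtain ⟨k, hk, hmin⟩ := Finset.exists_min_image (Finset.Icc (i + 1) j) y
    ⟨i + 1, Finset.mem_Icc.2 ⟨le_rfl, by omega⟩⟩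
  rw [Finset.mem_Icc] at hk
  have hmin' : ∀ l, i + 1 ≤ l → l ≤ j → y k ≤ y l := fun l h1 h2 =>
    hmin l (Finset.mem_Icc.2 ⟨h1, h2⟩)
  have hgk := hge k hk.1 hk.2
  have hgj := hge j (by omega) le_rfl
  have mi := hmin' (i + 1) le_rfl (by omega)
  have mj := hmin' j (by omega) le_rfl
  obtain ⟨J, rfl⟩ : ∃ J, j = J + 2 := ⟨j - 2, by omega⟩
  have vi1 : v (i + 1) = 0 := by
    have := hd.alt_right (i := i) (by omega)
    omega
  have vi2 : v (i + 2) ≠ 0 := (hd.alt_right (i := i + 1) (by omega)).1 vi1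
  have vJ1 : v (J + 1) = 0 := by
    have := hd.alt_right (i := J + 1) (by omega)
    change _ ↔ v (J + 2) ≠ 0 at this
    omega
  have vJ : v J ≠ 0 := by
    have := hd.alt_right (i := J) (by omega)
    omega
  have yi1 : y (i + 2) = y (i + 1) := hC.stepY.eq (by omega) vi1
  have yi2 : y (i + 3) ≠ y (i + 2) := hC.stepY.ne (by omega) vi2
  have yJ : y (J + 1) ≠ y J := hC.stepY.ne (by omega) vJ
  have yJ1 : y (J + 2) = y (J + 1) := hC.stepY.eq (by omega) vJ1
  have xi0 : x (i + 1) = x i := hC.stepX.eq (by omega) (hd.left_eq_zero (by omega) hvi)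
  have xi2 : x (i + 3) = x (i + 2) := hC.stepX.eq (by omega) (hd.left_eq_zero (by omega) vi2)
  have xJ0 : x (J + 1) = x J := hC.stepX.eq (by omega) (hd.left_eq_zero (by omega) vJ)
  have xJ2 : x (J + 3) = x (J + 2) := hC.stepX.eq (by omega) (hd.left_eq_zero (by omega) hvj)
  have hJ : i + 1 ≠ J := by
    rintro rfl
    exact vJ vi1
  have hlow : y i ≤ h := by omega
  have hlow' : y (J + 3) ≤ h := by
    change (_ ∧ _ ≤ y (J + 3)) ∨ (y (J + 3) ≤ _ ∧ _) at hsj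
    omega
  have spi : ∀ l, h < l → l < y (i + 1) → Spans y i l := fun l h1 h2 => by
    clear * - hlow h1 h2
    omega
  have spj : ∀ l, h < l → l < y (J + 2) → Spans y (J + 2) l := fun l h1 h2 => by
    change (_ ∧ _ ≤ y (J + 3)) ∨ (y (J + 3) ≤ _ ∧ _)
    clear * - hlow' h1 h2
    omega
  have hsep : ∀ p q, p + 1 < q → q ≤ n → Btw (y k) (y p) (y (p + 1)) →
      Btw (y k) (y q) (y (q + 1)) → max (x p) (x (p + 1)) < min (x q) (x (q + 1)) ∨
        max (x q) (x (q + 1)) < min (x p) (x (p + 1)) := fun p q hpq hq e1 e2 =>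
    separated_of_disjoint fun a e3 e4 => hC.apart p q hpq hq a (y k) e3 e1 e4 e2
  clear hno hge hmin hsi hsj
  -- If segment `i` ends on the minimum level, or segment `j` starts there, the adjacent horizontal
  -- segment lies on that level. It is separated there from the segment at the other end, so the
  -- comparison of inner crossings passes to the outer ones.
  by_cases hi1 : y (i + 1) = y k
  · have hs2 : Spans y (i + 2) (y k) := by
      have := hmin' (i + 3) (by omega) (by omega)
      exact .inl ⟨by omega, show _ ≤ y (i + 3) by omega⟩
    have hbi : Btw (y k) (y (i + 1)) (y (i + 2)) := .inl ⟨by omega, by omega⟩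
    by_cases hj1 : y (J + 2) = y k
    · have hiJ : i + 2 ≠ J := by
        rintro rfl
        change y (i + 3) ≠ _ at yJ
        change _ = y (i + 3) at yJ1
        omega
      have hsJ : Spans y J (y k) := by
        have := hmin' J (by omega) (by omega)
        exact .inr ⟨by omega, by omega⟩
      have hlt := ih (i + 2) J (y k) (by omega) (by omega) (by omega) vi2 vJ hs2 hsJ
      have hsep := hsep (i + 1) (J + 1) (by omega) (by omega) hbi
        (.inl ⟨by omega, show _ ≤ y (J + 2) by omega⟩)
      change (max (x (i + 1)) (x (i + 2)) < min _ (x (J + 2))) ∨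
        (max _ (x (J + 2)) < min (x (i + 1)) (x (i + 2))) at hsep
      clear * - hsep hlt xi0 xJ0
      omega
    · have hlt := ih (i + 2) (J + 2) (y k) (by omega) (by omega) (by omega) vi2 hvj
        hs2 (spj _ (by omega) (by omega))
      have hsep := hsep (i + 1) (J + 2) (by omega) (by omega) hbi
        (.inr ⟨show y (J + 3) ≤ _ by omega, by omega⟩)
      change (max (x (i + 1)) (x (i + 2)) < min _ (x (J + 3))) ∨
        (max _ (x (J + 3)) < min (x (i + 1)) (x (i + 2))) at hsep
      clear * - hsep hlt xi0 xJ2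
      omega
  · by_cases hj1 : y (J + 2) = y k
    · have hsJ : Spans y J (y k) := by
        have := hmin' J (by omega) (by omega)
        exact .inr ⟨by omega, by omega⟩
      have hlt := ih i J (y k) (by omega) (by omega) (by omega) hvi vJ
        (spi _ (by omega) (by omega)) hsJ
      have hsep := hsep i (J + 1) (by omega) (by omega) (.inl ⟨by omega, by omega⟩)
        (.inl ⟨by omega, show _ ≤ y (J + 2) by omega⟩)
      change (max _ _ < min _ (x (J + 2))) ∨ (max _ (x (J + 2)) < min _ _) at hsep
      clear * - hsep hlt xi0 xJ0
      omega
    · have hk1 : k ≠ i + 1 := by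
        rintro rfl
        exact hi1 rfl
      have hk2 : k ≠ J + 2 := by
        rintro rfl
        exact hj1 rfl
      obtain ⟨l, rfl⟩ : ∃ l, k = l + 1 := ⟨k - 1, by omega⟩
      have mk := hmin' l (by omega) (by omega)
      have mk2 := hmin' (l + 1 + 1) (by omega) (by omega)
      -- Both outer segments cross the raised strip, and so does the vertical segment at the lowest
      -- vertex: compare through it.
      obtain ⟨l', hl1, hl2, hl3, hl4⟩ : ∃ l', i < l' ∧ l' < J + 2 ∧ v l' ≠ 0 ∧
          Spans y l' (y (l + 1)) := by
        by_cases hv : v l = 0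
        · have hv' := (hd.alt_right (i := l) (by omega)).1 hv
          have := hC.stepY.ne (i := l + 1) (by omega) hv'
          exact ⟨l + 1, by omega, by omega, hv', .inl ⟨le_rfl, by omega⟩⟩
        · have := hC.stepY.ne (i := l) (by omega) hv
          exact ⟨l, by omega, by omega, hv, .inr ⟨le_rfl, by omega⟩⟩
      exact (ih l' (J + 2) _ hl2 hj (by omega) hl3 hvj hl4 (spj _ (by omega) (by omega))).trans
        (ih i l' _ hl1 (by omega) (by omega) hvi hl3 (spi _ (by omega) (by omega)) hl4)

/-- In a chain without right hooks, later crossings of a horizontal strip are to the left of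
earlier ones. -/
theorem GridChain.lt_of_spans {n : ℕ} {u v x y : ℕ → ℤ} (hd : Dirs n u v)
    (hC : GridChain n u v x y) (hno : ∀ i, i + 2 ≤ n → v i = -v (i + 2) → u (i + 1) ≠ 1)
    (i j : ℕ) (h : ℤ) (hij : i < j) (hj : j ≤ n) (hvi : v i ≠ 0) (hvj : v j ≠ 0)
    (hsi : Spans y i h) (hsj : Spans y j h) : x j < x i := by
  induction hm : j - i using Nat.strong_induction_on generalizing i j h with
  | _ m ih =>
    subst hm
    have ih' : ∀ i' j' h', i' < j' → j' ≤ n → j' - i' < j - i → v i' ≠ 0 → v j' ≠ 0 →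
        Spans y i' h' → Spans y j' h' → x j' < x i' :=
      fun i' j' h' h1 h2 h3 h4 h5 h6 h7 => ih _ h3 i' j' h' h1 h2 h4 h5 h6 h7 rfl
    by_cases hk : ∃ k, i < k ∧ k < j ∧ v k ≠ 0 ∧ Spans y k h
    · obtain ⟨k, h1, h2, h3, h4⟩ := hk
      exact (ih' k j h h2 hj (by omega) h3 hvj h4 hsj).trans
        (ih' i k h h1 (by omega) (by omega) hvi h3 hsi h4)
    · have hk' : ∀ k, i < k → k < j → v k ≠ 0 → ¬ Spans y k h :=
        fun k h1 h2 h3 h4 => hk ⟨k, h1, h2, h3, h4⟩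
      have ai := hd.alt_right (i := i) (by omega)
      have hne : j ≠ i + 1 := by
        rintro rfl
        omega
      rcases Nat.lt_or_ge (i + 2) j with hlt | hge
      · rcases hsi with hup | hdown
        · exact hC.lt_of_spans_of_above hd ih' hlt hj hvi hvj (.inl hup) hsj hk' hup.2
        · have hC' : GridChain n u (fun i => -v i) x (fun k => -y k) :=
            ⟨hC.stepX, fun i hi => by have := hC.stepY i hi; omega, fun i j hij hj a b e1 e2 e3 e4 =>
              hC.apart i j hij hj a (-b) e1 (by omega) e3 (by omega)⟩
          -- Reflection turns the strip from `h` to `h + 1` into the one from `-h - 1` to `-h`.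
          refine hC'.lt_of_spans_of_above hd.swap.neg_left.swap (h := -h - 1) ?_ hlt hj ?_ ?_ ?_ ?_
            ?_ ?_
          · intro i' j' h' h1 h2 h3 h4 h5 h6 h7
            simp only [Spans] at h6 h7
            exact ih' i' j' (-h' - 1) h1 h2 h3 (by omega) (by omega) (by omega) (by omega)
          · omega
          · omega
          · simp only [Spans]; omega
          · simp only [Spans]; omega
          · intro k h1 h2 h3 h4
            simp only [Spans] at h4
            exact hk' k h1 h2 (by omega) (by omega)
          · omega
      · obtain rfl : j = i + 2 := by omega
        have hno' := hno i hj
        have s1 := hC.stepX (i + 1) (by omega)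
        have s0 := hC.stepX i (by omega)
        have t0 := hC.stepY i (by omega)
        have t1 := hC.stepY (i + 1) (by omega)
        have t2 := hC.stepY (i + 2) (by omega)
        have d0 := hd.dir i (by omega)
        have d1 := hd.dir (i + 1) (by omega)
        change (_ ∧ x (i + 2) = _) ∨ (_ ∧ _ < x (i + 2)) ∨ (_ ∧ x (i + 2) < _) at s1
        change (_ ∧ y (i + 2) = _) ∨ (_ ∧ _ < y (i + 2)) ∨ (_ ∧ y (i + 2) < _) at t1
        omega

/-- Reachable points on the positive x-axis require a right hook. -/
theorem exists_hook_of_reach {n : ℕ} {u v : ℕ → ℤ} (hd : Dirs n u v) (hn : 1 ≤ n) {a : ℤ}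
    (ha : 0 < a) (h : Reach n u v a 0) :
    ∃ i, i + 2 ≤ n ∧ v i = -v (i + 2) ∧ u (i + 1) = 1 := by
  by_contra hcon
  have hno : ∀ i, i + 2 ≤ n → v i = -v (i + 2) → u (i + 1) ≠ 1 :=
    fun i h1 h2 h3 => hcon ⟨i, h1, h2, h3⟩
  obtain ⟨x, y, hC, h1, h2, h3, h4⟩ := h
  obtain ⟨N, rfl⟩ : ∃ N, n = N + 1 := ⟨n - 1, by omega⟩
  have d0 := hd.dir 0 (by omega)
  have d1 := hd.dir 1 (by omega)
  have a0 := hd.alt 0 (by omega)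
  have dN := hd.dir N (by omega)
  have dN1 := hd.dir (N + 1) le_rfl
  have aN := hd.alt N (by omega)
  have s0 := hC.stepY 0 (by omega)
  have s1 := hC.stepY 1 (by omega)
  have sN := hC.stepY N (by omega)
  have sN1 := hC.stepY (N + 1) (by omega)
  have t0 := hC.stepX 0 (by omega)
  have t1 := hC.stepX 1 (by omega)
  have tN := hC.stepX N (by omega)
  have tN1 := hC.stepX (N + 1) (by omega)
  simp only [zero_add, Nat.reduceAdd] at s0 s1 t0 t1 a0
  -- the first and the last vertical segment
  obtain ⟨i, hi, hvi⟩ : ∃ i, ((i = 0 ∧ v 0 ≠ 0) ∨ (i = 1 ∧ v 0 = 0)) ∧ v i ≠ 0 := by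
    by_cases hv : v 0 = 0
    · exact ⟨1, by omega, by omega⟩
    · exact ⟨0, by omega, by omega⟩
  obtain ⟨j, hj, hvj⟩ : ∃ j, ((j = N + 1 ∧ v (N + 1) ≠ 0) ∨ (j = N ∧ v (N + 1) = 0)) ∧ v j ≠ 0 := by
    by_cases hv : v (N + 1) = 0
    · exact ⟨N, by omega, by omega⟩
    · exact ⟨N + 1, by omega, by omega⟩
  have hyi : y i = 0 := by
    rcases hi with ⟨rfl, _⟩ | ⟨rfl, _⟩ <;> omega
  have hyj : y (j + 1) = 0 := by
    rcases hj with ⟨rfl, _⟩ | ⟨rfl, _⟩ <;> omega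
  have si := hC.stepY i (by omega)
  have sj := hC.stepY j (by omega)
  have hij : i < j := by
    by_contra hge
    have : i = j ∨ (N = 0 ∧ i = 1 ∧ j = 0) := by omega
    rcases this with rfl | ⟨rfl, rfl, rfl⟩
    · omega
    · omega
  -- The end leaves level 0 by one unit in the direction of the first vertical segment, while all
  -- other levels double. The first and the last vertical segment then cross a common strip.
  let y' : ℕ → ℤ := fun k => if j + 1 ≤ k then v i else 2 * y k
  have hlast : ∀ k ≤ N + 1 + 1, j + 1 ≤ k → y k = 0 := by
    intro k hk hjk
    have : k = j + 1 ∨ k = N + 1 + 1 := by omega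
    rcases this with rfl | rfl
    · exact hyj
    · exact h4
  have di := hd.dir i (by omega)
  have hC' : GridChain (N + 1) u v x y' := by
    refine hC.move (fun k hk hv => ?_) (fun k hk l hl hkl => ?_)
    · have := hC.stepY k hk
      have hkj : k ≠ j := by
        rintro rfl
        exact hvj hv
      simp only [y']
      split_ifs <;> omega
    · have e1 := hlast k hk
      have e2 := hlast l hl
      simp only [y']
      split_ifs <;> omega
  have y1 : y' i = 0 := by
    simp only [y']
    rw [if_neg (by omega), hyi, mul_zero]
  have y2 : y' (i + 1) = 2 * y (i + 1) := by
    simp only [y']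
    rw [if_neg (by omega)]
  have y3 : y' j = 2 * y j := by
    simp only [y']
    rw [if_neg (by omega)]
  have y4 : y' (j + 1) = v i := by
    simp only [y']
    rw [if_pos le_rfl]
  -- The common strip is on one side of level `v i`, namely the side from which the last vertical
  -- segment arrives.
  have hlt : x j < x i := by
    have key := fun h => hC'.lt_of_spans hd hno i j h hij (by omega) hvi hvj
    have k1 := key 0
    have k2 := key 1
    have k3 := key (-1)
    have k4 := key (-2)
    simp only [Spans, y1, y2, y3, y4] at k1 k2 k3 k4
    rw [hyi] at si
    rw [hyj] at sj
    clear key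
    rcases lt_or_gt_of_ne (show y j ≠ 0 by omega) with g | g <;>
    rcases di.resolve_right (fun h => hvi h.1) with ⟨-, g' | g'⟩
    · exact k1 (by omega) (by omega)
    · exact k4 (by omega) (by omega)
    · exact k2 (by omega) (by omega)
    · exact k3 (by omega) (by omega)
  -- In the original chain, a horizontal first or last segment lies on level 0 and is separated from
  -- the opposite extreme segment. This carries `x j < x i` over to the two ends of the chain,
  -- against `0 < a`.
  have hap : ∀ p ≤ N + 1, ∀ q ≤ N + 1, p + 1 < q → Btw 0 (y p) (y (p + 1)) →
      Btw 0 (y q) (y (q + 1)) → max (x p) (x (p + 1)) < min (x q) (x (q + 1)) ∨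
        max (x q) (x (q + 1)) < min (x p) (x (p + 1)) := fun p hp q hq hpq e1 e2 =>
    separated_of_disjoint fun a e3 e4 => hC.apart p q hpq hq a 0 e3 e1 e4 e2
  rcases hi with ⟨rfl, hi⟩ | ⟨rfl, hi⟩ <;> rcases hj with ⟨rfl, hj⟩ | ⟨rfl, hj⟩
  · omega
  · have := hap 0 (by omega) (j + 1) (by omega) (by omega) (by omega) (by omega)
    simp only [zero_add] at this
    omega
  · have hN : N ≠ 0 := by
      rintro rfl
      omega
    have := hap 0 (by omega) (N + 1) (by omega) (by omega) (by simp only [zero_add]; omega) (by omega)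
    simp only [zero_add] at this
    omega
  · have := hap 0 (by omega) (j + 1) (by omega) (by omega) (by simp only [zero_add]; omega) (by omega)
    simp only [zero_add] at this
    omega

/-! ### Paths that force the end to stay above the start -/

/-- The vertical unit segment from `(c, t)` to `(c, t + 1)` is a part of the chain. -/
def UnitEdge (n : ℕ) (x y : ℕ → ℤ) (c t : ℤ) : Prop :=
  ∃ i ≤ n, x i = c ∧ x (i + 1) = c ∧ Btw t (y i) (y (i + 1)) ∧ Btw (t + 1) (y i) (y (i + 1))

/-- A unit step upwards, or a horizontal unit step along the chain. -/
def UpStep (n : ℕ) (x y : ℕ → ℤ) (f g : ℤ × ℤ) : Prop :=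
  (g.1 = f.1 ∧ g.2 = f.2 + 1) ∨ (g.2 = f.2 ∧ g.1 = f.1 + 1 ∧ UnitEdge n y x f.2 f.1) ∨
    (g.2 = f.2 ∧ f.1 = g.1 + 1 ∧ UnitEdge n y x f.2 g.1)

theorem upStep_rise (n : ℕ) (x y : ℕ → ℤ) (c : ℤ) {t t' : ℤ} (h : t ≤ t') :
    Relation.ReflTransGen (UpStep n x y) (c, t) (c, t') := by
  induction t', h using Int.leInduction with
  | base => exact .refl
  | succ t' _ ih => exact ih.tail (.inl ⟨rfl, rfl⟩)

theorem upStep_slide_aux {n : ℕ} {x y : ℕ → ℤ} {i : ℕ} (hi : i ≤ n) (he : y (i + 1) = y i)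
    {p q : ℤ} (h : p ≤ q) (hp : Btw p (x i) (x (i + 1))) (hq : Btw q (x i) (x (i + 1))) :
    Relation.ReflTransGen (UpStep n x y) (p, y i) (q, y i) ∧
      Relation.ReflTransGen (UpStep n x y) (q, y i) (p, y i) := by
  induction q, h using Int.leInduction with
  | base => exact ⟨.refl, .refl⟩
  | succ q hpq ih =>
    have hq' : Btw q (x i) (x (i + 1)) := by omega
    have hE : UnitEdge n y x (y i) q := ⟨i, hi, rfl, he, hq', hq⟩
    obtain ⟨h1, h2⟩ := ih hq'
    exact ⟨h1.tail (.inr (.inl ⟨rfl, rfl, hE⟩)), Relation.ReflTransGen.head (b := (q, y i)) (.inr (.inr ⟨rfl, rfl, hE⟩)) h2⟩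

theorem upStep_slide {n : ℕ} {x y : ℕ → ℤ} {i : ℕ} (hi : i ≤ n) (he : y (i + 1) = y i)
    {p q : ℤ} (hp : Btw p (x i) (x (i + 1))) (hq : Btw q (x i) (x (i + 1))) :
    Relation.ReflTransGen (UpStep n x y) (p, y i) (q, y i) := by
  rcases le_total p q with h | h
  · exact (upStep_slide_aux hi he h hp hq).1
  · exact (upStep_slide_aux hi he h hq hp).2

/-- A horizontal segment can be followed both ways, and a vertical one has only the column `a`.
Hence vertices can be compared within any column that their segments share. -/
theorem GridChain.upStep_column {n : ℕ} {u v x y : ℕ → ℤ} (hC : GridChain n u v x y)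
    (hd : Dirs n u v) {i : ℕ} (hi : i ≤ n) {a : ℤ} (ha : Btw a (x i) (x (i + 1))) {k : ℕ}
    (hk : k = i ∨ k = i + 1) : Relation.ReflTransGen (UpStep n x y) (x k, y k) (a, y k) ∧
      Relation.ReflTransGen (UpStep n x y) (a, y k) (x k, y k) := by
  by_cases hv : v i = 0
  · have he := hC.stepY.eq hi hv
    have hy : y k = y i := by
      rcases hk with rfl | rfl
      · rfl
      · exact he
    have hx : Btw (x k) (x i) (x (i + 1)) := by
      rcases hk with rfl | rfl <;> omega
    rw [hy]
    exact ⟨upStep_slide hi he hx ha, upStep_slide hi he ha hx⟩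
  · have he := hC.stepX.eq hi (hd.left_eq_zero hi hv)
    have hx : x k = a := by
      rcases hk with rfl | rfl <;> omega
    rw [hx]
    exact ⟨.refl, .refl⟩

/-- If the last vertex is not forced to be above the first one, then it can be moved vertically
to the level of the first one. -/
theorem GridChain.reach_of_not_upStep {n : ℕ} {u v x y : ℕ → ℤ} (hC : GridChain n u v x y)
    (hd : Dirs n u v) (hx : x 0 = 0) (hy : y 0 = 0) (hb : 0 ≤ y (n + 1))
    (h : ¬ Relation.ReflTransGen (UpStep n x y) (x 0, y 0) (x (n + 1), y (n + 1))) :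
    Reach n u v (x (n + 1)) 0 := by
  classical
  let S : ℕ → Prop := fun k => Relation.ReflTransGen (UpStep n x y) (x 0, y 0) (x k, y k)
  have hS : ∀ i ≤ n, ∀ j ≤ n, ∀ a, Btw a (x i) (x (i + 1)) → Btw a (x j) (x (j + 1)) →
      ∀ k l, (k = i ∨ k = i + 1) → (l = j ∨ l = j + 1) → y k ≤ y l → S k → S l := by
    intro i hi j hj a h1 h2 k l hk hl hkl hs
    exact hs.trans ((hC.upStep_column hd hi h1 hk).1.trans
      ((upStep_rise n x y a hkl).trans (hC.upStep_column hd hj h2 hl).2))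
  have hseg : ∀ i ≤ n, (y i ≤ y (i + 1) → S i → S (i + 1)) ∧
      (y (i + 1) ≤ y i → S (i + 1) → S i) := fun i hi =>
    ⟨hS i hi i hi (x i) (by omega) (by omega) _ _ (.inl rfl) (.inr rfl),
      hS i hi i hi (x i) (by omega) (by omega) _ _ (.inr rfl) (.inl rfl)⟩
  -- `S` is closed upwards within shared columns, so lowering its complement by the height of the
  -- end keeps the order there. The start belongs to `S` and stays; the end does not and drops to
  -- level 0.
  refine ⟨x, fun k => if S k then y k else y k - y (n + 1), ⟨hC.stepX, fun i hi => ?_, ?_⟩, hx, ?_,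
    rfl, ?_⟩
  · have h1 := hC.stepY i hi
    obtain ⟨h2, h3⟩ := hseg i hi
    by_cases s1 : S i <;> by_cases s2 : S (i + 1)
    · rw [if_pos s1, if_pos s2]
      exact h1
    · have : y (i + 1) < y i := by
        by_contra hc
        exact s2 (h2 (by omega) s1)
      rw [if_pos s1, if_neg s2]
      omega
    · have : y i < y (i + 1) := by
        by_contra hc
        exact s1 (h3 (by omega) s2)
      rw [if_neg s1, if_pos s2]
      omega
    · rw [if_neg s1, if_neg s2]
      omega
  · refine hC.apart.move_of_column fun i hi j hj a h1 h2 k l hk hl hkl => ?_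
    have := hS i hi j hj a h1 h2 k l hk hl hkl.le
    by_cases s1 : S k
    · rw [if_pos s1, if_pos (this s1)]
      exact hkl
    · rw [if_neg s1]
      split_ifs <;> omega
  · exact (if_pos (show S 0 from .refl)).trans hy
  · exact (if_neg h).trans (sub_self _)

/-! ### The two forcing paths exclude each other -/

theorem GridChain.adjacent {n : ℕ} {u v x y : ℕ → ℤ} (hC : GridChain n u v x y) {i j : ℕ}
    (hi : i ≤ n) (hj : j ≤ n) {c t : ℤ} (h1 : Btw c (x i) (x (i + 1)))
    (h2 : Btw t (y i) (y (i + 1))) (h3 : Btw c (x j) (x (j + 1))) (h4 : Btw t (y j) (y (j + 1))) :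
    i = j ∨ i + 1 = j ∨ j + 1 = i := by
  by_contra hne
  rcases Nat.lt_or_ge i j with h | h
  · exact hC.apart i j (by omega) hj c t h1 h2 h3 h4
  · exact hC.apart j i (by omega) hi c t h3 h4 h1 h2

theorem GridChain.not_degenerate {n : ℕ} {u v x y : ℕ → ℤ} (hC : GridChain n u v x y)
    (hd : Dirs n u v) {i : ℕ} (hi : i ≤ n) (hx : x (i + 1) = x i) : y (i + 1) ≠ y i := by
  by_cases hv : v i = 0
  · exact absurd hx (hC.stepX.ne hi (hd.left_ne_zero hi hv))
  · exact hC.stepY.ne hi hv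

/-- A chain has no branching points. -/
theorem GridChain.no_branch {n : ℕ} {u v x y : ℕ → ℤ} (hC : GridChain n u v x y)
    (hd : Dirs n u v) {c t : ℤ} {j : ℕ} (hj : j ≤ n) (hjy : y (j + 1) = y j)
    (hc : Btw c (x j) (x (j + 1))) (ht : y j = t) (h1 : UnitEdge n x y c (t - 1))
    (h2 : UnitEdge n x y c t) : False := by
  obtain ⟨i, hi, i1, i2, i3, i4⟩ := h1
  obtain ⟨k, hk, k1, k2, k3, k4⟩ := h2
  have hn := hC.not_degenerate hd hj
  -- Both edges belong to neighbours of segment `j`. The same neighbour cannot extend to both sides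
  -- of a vertex at which it starts or ends, and neighbours at different ends of `j` have different
  -- columns.
  have a1 := hC.adjacent hi hj (c := c) (t := t) (by omega) (by omega) hc (by omega)
  have a2 := hC.adjacent hk hj (c := c) (t := t) (by omega) (by omega) hc (by omega)
  have hij : i ≠ j := by
    rintro rfl
    omega
  have hkj : k ≠ j := by
    rintro rfl
    omega
  rcases a1.resolve_left hij with rfl | rfl <;> rcases a2.resolve_left hkj with h | h
  · obtain rfl : k = i := by omega
    omega
  · subst h
    omega
  · subst h
    omega
  · obtain rfl : k = j + 1 := by omega
    omega

/-- Only segment 1 could be another one, but it is perpendicular to segment 0 and begins at the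
other end of it. -/
theorem GridChain.eq_zero_of_start {n : ℕ} {u v x y : ℕ → ℤ} (hC : GridChain n u v x y)
    (hd : Dirs n u v) {i : ℕ} (hi : i ≤ n) (h1 : Btw (x 0) (x i) (x (i + 1)))
    (h2 : Btw (y 0) (y i) (y (i + 1))) : i = 0 := by
  have := hC.adjacent hi (Nat.zero_le n) h1 h2 (by omega) (by omega)
  by_contra hne
  obtain rfl : i = 1 := by omega
  have a0 := hd.alt 0 (by omega)
  have d0 := hd.dir 0 (by omega)
  have d1 := hd.dir 1 (by omega)
  have s0 := hC.stepX 0 (by omega)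
  have s1 := hC.stepX 1 (by omega)
  have t0 := hC.stepY 0 (by omega)
  have t1 := hC.stepY 1 (by omega)
  simp only [zero_add] at a0 s0 t0
  omega

theorem GridChain.eq_of_end {n : ℕ} {u v x y : ℕ → ℤ} (hC : GridChain n u v x y)
    (hd : Dirs n u v) {i : ℕ} (hi : i ≤ n) (h1 : Btw (x (n + 1)) (x i) (x (i + 1)))
    (h2 : Btw (y (n + 1)) (y i) (y (i + 1))) : i = n := by
  have := hC.adjacent hi le_rfl h1 h2 (by omega) (by omega)
  by_contra hne
  obtain rfl : n = i + 1 := by omega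
  have a0 := hd.alt i (by omega)
  have d0 := hd.dir i (by omega)
  have d1 := hd.dir (i + 1) (by omega)
  have s0 := hC.stepX i (by omega)
  have s1 := hC.stepX (i + 1) (by omega)
  have t0 := hC.stepY i (by omega)
  have t1 := hC.stepY (i + 1) (by omega)
  omega

/-- A monotone path to the right, along vertical unit edges, meets each column in an interval. -/
theorem exists_columns {n : ℕ} {x y : ℕ → ℤ} {f g : ℤ × ℤ}
    (h : Relation.ReflTransGen (UpStep n y x) f g) :
    ∃ lo hi : ℤ → ℤ, f.2 ≤ g.2 ∧ (lo f.2 ≤ f.1 ∧ f.1 ≤ hi f.2) ∧ (lo g.2 ≤ g.1 ∧ g.1 ≤ hi g.2) ∧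
      (∀ c, g.2 < c → lo c = g.1 ∧ hi c = g.1) ∧ (∀ c, lo c ≤ hi (c + 1) ∧ lo (c + 1) ≤ hi c) ∧
      ∀ c t, lo c ≤ t → t < hi c → UnitEdge n x y c t := by
  induction h with
  | refl => exact ⟨fun _ => f.1, fun _ => f.1, le_rfl, by simp, by simp, by simp, by simp,
      fun c t h1 h2 => by omega⟩
  | @tail g g' _ hs ih =>
    obtain ⟨lo, hi, h1, h2, h3, h4, h5, h6⟩ := ih
    obtain ⟨Y, X⟩ := g
    obtain ⟨Y', X'⟩ := g'
    dsimp only at *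
    rcases hs with ⟨e1, e2⟩ | ⟨e1, e2, hE⟩ | ⟨e1, e2, hE⟩
    · dsimp only at e1 e2
      subst e1 e2
      have := h4 (X + 1) (by omega)
      exact ⟨lo, hi, by omega, h2, by omega, fun c hc => h4 c (by omega), h5, h6⟩
    · dsimp only at e1 e2 hE
      subst e1 e2
      -- The columns not yet visited carry the current height as a default value, so that
      -- neighbouring intervals keep overlapping.
      refine ⟨fun c => if c ≤ X' then lo c else Y + 1,
        fun c => if c < X' then hi c else max (if c = X' then hi c else Y + 1) (Y + 1), h1, ?_, ?_, ?_,
        fun c => ?_, fun c t => ?_⟩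
      · dsimp only
        split_ifs <;> omega
      · simp only [le_refl, if_true, lt_irrefl, if_false]
        omega
      · intro c hc
        dsimp only
        rw [if_neg (by omega), if_neg (by omega), if_neg (by omega)]
        omega
      · have := h5 c
        have := h4 (c + 1)
        dsimp only
        split_ifs <;> omega
      · have := h6 c t
        dsimp only
        rcases lt_trichotomy c X' with hc | rfl | hc
        · rw [if_pos hc, if_pos hc.le]
          exact this
        · rw [if_pos le_rfl, if_neg (lt_irrefl _), if_pos rfl]
          intro l1 l2
          by_cases l3 : t < hi c
          · exact this l1 l3
          · obtain rfl : t = Y := by omega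
            exact hE
        · rw [if_neg (by omega), if_neg (by omega), if_neg (by omega)]
          omega
    · dsimp only at e1 e2 hE
      subst e1 e2
      refine ⟨fun c => if c < X' then lo c else min (if c = X' then lo c else Y') Y',
        fun c => if c ≤ X' then hi c else Y', h1, ?_, ?_, ?_, fun c => ?_, fun c t => ?_⟩
      · dsimp only
        split_ifs <;> omega
      · simp only [le_refl, if_true, lt_irrefl, if_false]
        omega
      · intro c hc
        dsimp only
        rw [if_neg (by omega), if_neg (by omega), if_neg (by omega)]
        omega
      · have := h5 c
        have := h4 (c + 1)
        dsimp only
        split_ifs <;> omega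
      · have := h6 c t
        dsimp only
        rcases lt_trichotomy c X' with hc | rfl | hc
        · rw [if_pos hc, if_pos hc.le]
          exact this
        · rw [if_pos le_rfl, if_neg (lt_irrefl _), if_pos rfl]
          intro l1 l2
          by_cases l3 : lo c ≤ t
          · exact this l3 l2
          · obtain rfl : t = Y' := by omega
            exact hE
        · rw [if_neg (by omega), if_neg (by omega), if_neg (by omega)]
          omega

/-- A chain that heads down at first, and down or left at last, does not force its last vertex to
be both to the right of and above the first one. -/
theorem GridChain.not_forced {n : ℕ} {u v x y : ℕ → ℤ} (hC : GridChain n u v x y)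
    (hd : Dirs n u v) (h0 : v 0 = -1) (hn : v n = -1 ∨ u n = -1)
    (hr : Relation.ReflTransGen (UpStep n y x) (y 0, x 0) (y (n + 1), x (n + 1)))
    (hu : Relation.ReflTransGen (UpStep n x y) (x 0, y 0) (x (n + 1), y (n + 1))) : False := by
  obtain ⟨lo, hi, -, s1, e1, -, hov, hed⟩ := exists_columns hr
  dsimp only at s1 e1
  have sx0 := hC.stepX.eq (Nat.zero_le n) (hd.left_eq_zero (Nat.zero_le n) (by omega))
  have sy0 : y (0 + 1) < y 0 := by
    have := hC.stepY 0 (Nat.zero_le n)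
    omega
  -- the path stays above the columns, except that it may visit corners at their tops
  let J : ℤ × ℤ → Prop := fun f => hi f.1 < f.2 ∨ (hi f.1 = f.2 ∧ UnitEdge n x y f.1 (f.2 - 1) ∧
    ((UnitEdge n y x f.2 (f.1 - 1) ∧ hi (f.1 - 1) < f.2) ∨
      (UnitEdge n y x f.2 f.1 ∧ hi (f.1 + 1) < f.2)))
  have branchV : ∀ {c t c'}, UnitEdge n y x t c' → (c = c' ∨ c = c' + 1) →
      UnitEdge n x y c (t - 1) → UnitEdge n x y c t → False := by
    rintro c t c' ⟨j, hj, j1, j2, j3, j4⟩ hc h1 h2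
    exact hC.no_branch hd hj (by omega) (by omega) j1 h1 h2
  have branchH : ∀ {c t t'}, UnitEdge n x y c t' → (t = t' ∨ t = t' + 1) →
      UnitEdge n y x t (c - 1) → UnitEdge n y x t c → False := by
    rintro c t t' ⟨j, hj, j1, j2, j3, j4⟩ hc h1 h2
    exact hC.swap.no_branch hd.swap hj (by omega) (by omega) j1 h1 h2
  -- At a corner, the chain already has an edge below and an edge towards a side whose column top is
  -- lower. Since there is no branching, the path can only rise or step to that side. Entering a
  -- corner from strictly above a column creates just this situation.
  have hJ : ∀ f g, UpStep n x y f g → J f → J g := by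
    rintro ⟨c, t⟩ ⟨c', t'⟩ hs hf
    rcases hs with ⟨r1, r2⟩ | ⟨r1, r2, hE⟩ | ⟨r1, r2, hE⟩
    · dsimp only at r1 r2
      subst r1 r2
      left
      rcases hf with hf | hf <;> dsimp only at hf ⊢ <;> omega
    · dsimp only at r1 r2 hE
      subst r1 r2
      rcases hf with hf | ⟨f1, f2, ⟨f3, -⟩ | ⟨-, f4⟩⟩
      · dsimp only at hf
        have := hov c
        by_cases hlt : hi (c + 1) < t'
        · exact .inl hlt
        · right
          have hE1 := hed (c + 1) (t' - 1) (by omega) (by omega)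
          have heq : hi (c + 1) = t' := by
            by_contra hne
            exact branchV hE (.inr rfl) hE1 (hed (c + 1) t' (by omega) (by omega))
          refine ⟨heq, hE1, .inl ?_⟩
          dsimp only
          rw [add_sub_cancel_right]
          exact ⟨hE, hf⟩
      · exact (branchH f2 (.inr (by dsimp only; omega)) f3 hE).elim
      · exact .inl f4
    · dsimp only at r1 r2 hE
      subst r1 r2
      rcases hf with hf | ⟨f1, f2, ⟨-, f4⟩ | ⟨f3, -⟩⟩
      · dsimp only at hf
        have := hov c'
        by_cases hlt : hi c' < t'
        · exact .inl hlt
        · right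
          have hE1 := hed c' (t' - 1) (by omega) (by omega)
          have heq : hi c' = t' := by
            by_contra hne
            exact branchV hE (.inl rfl) hE1 (hed c' t' (by omega) (by omega))
          exact ⟨heq, hE1, .inr ⟨hE, hf⟩⟩
      · dsimp only at f4
        rw [add_sub_cancel_right] at f4
        exact .inl f4
      · refine (branchH f2 (.inr (by dsimp only; omega)) ?_ f3).elim
        dsimp only
        rw [add_sub_cancel_right]
        exact hE
  have hJend : J (x (n + 1), y (n + 1)) := by
    rcases Relation.ReflTransGen.cases_head hu with heq | ⟨g, hs, hg⟩
    · rw [Prod.mk.injEq] at heq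
      obtain rfl := hC.eq_zero_of_start hd le_rfl (by omega) (by omega)
      omega
    -- A horizontal edge at the start, or an edge upwards from it, would belong to segment 0, which
    -- heads down. So the first step rises, and it leaves the interval of its column.
    · have hJg : J g := by
        obtain ⟨c', t'⟩ := g
        have hno : ∀ i ≤ n, y i = y 0 → y (i + 1) = y 0 → Btw (x 0) (x i) (x (i + 1)) → False := by
          intro i hi i1 i2 i3
          obtain rfl := hC.eq_zero_of_start hd hi i3 (by omega)
          omega
        rcases hs with ⟨r1, r2⟩ | ⟨r1, r2, j, hj, j1, j2, j3, j4⟩ | ⟨r1, r2, j, hj, j1, j2, j3, j4⟩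
        · left
          dsimp only at r1 r2 ⊢
          subst r1 r2
          by_contra hge
          obtain ⟨i, hi, i1, i2, i3, i4⟩ := hed (x 0) (y 0) s1.1 (by omega)
          obtain rfl := hC.eq_zero_of_start hd hi (by omega) i3
          omega
        · exact (hno j hj j1 j2 j3).elim
        · dsimp only at r2
          rw [r2] at hno
          exact (hno j hj j1 j2 j4).elim
      clear hs hu
      generalize (x (n + 1), y (n + 1)) = p at hg ⊢
      induction hg with
      | refl => exact hJg
      | tail _ hs ih => exact hJ _ _ hs ih
  have hend : ∀ i ≤ n, Btw (x (n + 1)) (x i) (x (i + 1)) → Btw (y (n + 1)) (y i) (y (i + 1)) →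
      i = n := fun i hi h1 h2 => hC.eq_of_end hd hi h1 h2
  -- The end lies in the interval of its column, so it is a corner. The edge below it belongs to the
  -- last segment, which would have to head up.
  rcases hJend with hJend | ⟨-, ⟨i, hi, i1, i2, i3, i4⟩, -⟩
  · dsimp only at hJend
    omega
  · dsimp only at i1 i2 i3 i4
    obtain rfl := hend i hi (by omega) (by omega)
    have hx := hC.stepX i le_rfl
    have hy := hC.stepY i le_rfl
    omega

/-! ### Projection of a reachable point to an axis -/

/-- Some segment between two equal turns. -/
def Hooked (n : ℕ) (u v : ℕ → ℤ) : Prop :=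
  ∃ i, i + 2 ≤ n ∧ u i = -u (i + 2) ∧ v i = -v (i + 2)

theorem Hooked.swap {n : ℕ} {u v : ℕ → ℤ} (h : Hooked n u v) : Hooked n v u := by
  obtain ⟨i, h1, h2, h3⟩ := h
  exact ⟨i, h1, h3, h2⟩

theorem Hooked.neg_left {n : ℕ} {u v : ℕ → ℤ} (h : Hooked n u v) : Hooked n (fun i => -u i) v := by
  obtain ⟨i, h1, h2, h3⟩ := h
  exact ⟨i, h1, by dsimp only; omega, h3⟩

theorem Hooked.rev {n : ℕ} {u v : ℕ → ℤ} (h : Hooked n u v) :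
    Hooked n (fun i => u (n - i)) (fun i => v (n - i)) := by
  obtain ⟨i, h1, h2, h3⟩ := h
  refine ⟨n - (i + 2), by omega, ?_, ?_⟩
  · have e1 : n - (n - (i + 2)) = i + 2 := by omega
    have e2 : n - (n - (i + 2) + 2) = i := by omega
    dsimp only
    rw [e1, e2]
    omega
  · have e1 : n - (n - (i + 2)) = i + 2 := by omega
    have e2 : n - (n - (i + 2) + 2) = i := by omega
    dsimp only
    rw [e1, e2]
    omega

/-- In a staircase that continues downwards, no segment heads upwards. -/
theorem Dirs.ne_one_of_not_hooked {n : ℕ} {u v : ℕ → ℤ} (hd : Dirs n u v)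
    (h : ¬ Hooked n u v) (h0 : v n = 0) (h1 : ∀ i, i + 1 = n → v i ≠ 1) : ∀ i ≤ n, v i ≠ 1 := by
  intro i hi
  induction hm : n - i using Nat.strong_induction_on generalizing i with
  | _ m ih =>
    subst hm
    rcases Nat.lt_or_ge (i + 1) n with hlt | hge
    · have h2 := ih (n - (i + 2)) (by omega) (i + 2) (by omega) rfl
      intro hv
      refine h ⟨i, by omega, ?_, ?_⟩
      all_goals
        have d0 := hd.dir i hi
        have d1 := hd.dir (i + 1) (by omega)
        have d2 := hd.dir (i + 2) (by omega)
        have a0 := hd.alt i (by omega)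
        have a1 := hd.alt (i + 1) (by omega)
        rw [show i + 1 + 1 = i + 2 from rfl] at a1
        omega
    · rcases Nat.eq_or_lt_of_le hi with rfl | hlt
      · omega
      · exact h1 i (by omega)

/-- The level at which the last segment begins decides: below 0 the segment is cut at the axis, on 0
it is appended to an axis point, and above 0 the shorter chain is projected by induction. -/
theorem Reach.axis_of_last_up {n : ℕ} {u v : ℕ → ℤ} {a b : ℤ} (hd : Dirs (n + 1) u v)
    (ih : ∀ a b, Hooked n u v → Reach n u v a b → a ≠ 0 → b ≠ 0 → Reach n u v a 0 ∨ Reach n u v 0 b)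
    (hk : Hooked (n + 1) u v) (hv : v (n + 1) = 1) (h : Reach (n + 1) u v a b) (ha : a ≠ 0)
    (hb : 0 < b) : Reach (n + 1) u v a 0 ∨ Reach (n + 1) u v 0 b := by
  have hn : 1 ≤ n := by
    obtain ⟨i, hi, -⟩ := hk
    omega
  obtain ⟨x, y, hC, h1, h2, h3, h4⟩ := h
  have hu : u (n + 1) = 0 := hd.left_eq_zero le_rfl (by omega)
  have hv0 : v n = 0 := (hd.alt_right (by omega)).2 (by omega)
  have hx := hC.stepX.eq le_rfl hu
  have hr : Reach n u v a (y (n + 1)) := ⟨x, y, hC.mono (by omega), h1, h2, by omega, rfl⟩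
  have hlt : y (n + 1) < b := by
    have := hC.stepY (n + 1) le_rfl
    omega
  rcases lt_trichotomy (y (n + 1)) 0 with hneg | hz | hpos
  · left
    rw [← h3]
    exact Reach.truncate hC hv h1 h2 hneg (by omega)
  · left
    rw [hz] at hr
    exact hr.append_axis hn hd hu
  · by_cases hk' : Hooked n u v
    · rcases ih a _ hk' hr ha hpos.ne' with h5 | h5
      · exact .inl (h5.append_axis hn hd hu)
      · exact .inr (h5.append_up hpos.le hd hv hlt)
    -- The only hook uses the last turn, so all earlier vertical segments head down, and the last
    -- segment cannot begin above level 0.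
    · exfalso
      have hle : ∀ i ≤ n, v i ≠ 1 := by
        refine (hd.mono (by omega)).ne_one_of_not_hooked hk' hv0 fun i hi => ?_
        obtain ⟨k, k1, k2, k3⟩ := hk
        have hki : k = i := by
          by_contra hne
          exact hk' ⟨k, by omega, k2, k3⟩
        subst hki
        have e : k + 2 = n + 1 := by omega
        rw [e] at k3
        omega
      have : ∀ k ≤ n + 1, y k ≤ 0 := by
        intro k
        induction k with
        | zero => exact fun _ => h2.le
        | succ k ih =>
          intro hk
          have s := hC.stepY k (by omega)
          have := hle k (by omega)
          have := ih (by omega)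
          omega
      have := this (n + 1) le_rfl
      omega

theorem Reach.axis_of_first_down {n : ℕ} {u v : ℕ → ℤ} {a b : ℤ} (hd : Dirs n u v)
    (h : Reach n u v a b) (ha : 0 < a) (hb : 0 < b) (h0 : v 0 = -1)
    (hn : v n = -1 ∨ u n = -1) : Reach n u v a 0 ∨ Reach n u v 0 b := by
  obtain ⟨x, y, hC, h1, h2, h3, h4⟩ := h
  by_cases hu : Relation.ReflTransGen (UpStep n x y) (x 0, y 0) (x (n + 1), y (n + 1))
  · right
    by_cases hr : Relation.ReflTransGen (UpStep n y x) (y 0, x 0) (y (n + 1), x (n + 1))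
    · exact (hC.not_forced hd h0 hn hr hu).elim
    · rw [← h4]
      exact (hC.swap.reach_of_not_upStep hd.swap h2 h1 (by omega) hr).swap
  · left
    rw [← h3]
    exact hC.reach_of_not_upStep hd h1 h2 (by omega) hu

/-- If the chain has a hook, then a reachable point can be projected to one of the axes. -/
theorem Reach.axis {n : ℕ} {u v : ℕ → ℤ} {a b : ℤ} (hd : Dirs n u v) (hk : Hooked n u v)
    (h : Reach n u v a b) (ha : a ≠ 0) (hb : b ≠ 0) : Reach n u v a 0 ∨ Reach n u v 0 b := by
  induction n generalizing u v a b with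
  | zero =>
    obtain ⟨i, hi, -⟩ := hk
    omega
  | succ n ih =>
    have up : ∀ {u v : ℕ → ℤ} {a b : ℤ}, Dirs (n + 1) u v → Hooked (n + 1) u v → v (n + 1) = 1 →
        Reach (n + 1) u v a b → 0 < a → 0 < b →
        Reach (n + 1) u v a 0 ∨ Reach (n + 1) u v 0 b :=
      fun hd hk hv h ha hb => Reach.axis_of_last_up hd
        (fun a b hk h ha hb => ih (hd.mono (by omega)) hk h ha hb) hk hv h ha.ne' hb
    have last : ∀ {u v : ℕ → ℤ} {a b : ℤ}, Dirs (n + 1) u v → Hooked (n + 1) u v →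
        (u (n + 1) = 1 ∨ v (n + 1) = 1) → Reach (n + 1) u v a b → 0 < a → 0 < b →
        Reach (n + 1) u v a 0 ∨ Reach (n + 1) u v 0 b := by
      rintro u v a b hd hk (hu | hv) h ha hb
      · exact (up hd.swap hk.swap hu h.swap hb ha).symm.imp Reach.swap Reach.swap
      · exact up hd hk hv h ha hb
    have first : ∀ {u v : ℕ → ℤ} {a b : ℤ}, Dirs (n + 1) u v → Hooked (n + 1) u v →
        (u 0 = 1 ∨ v 0 = 1) → Reach (n + 1) u v a b → 0 < a → 0 < b →
        Reach (n + 1) u v a 0 ∨ Reach (n + 1) u v 0 b := by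
      intro u v a b hd hk h0 h ha hb
      exact (last hd.rev hk.rev (by simpa using h0) h.rev ha hb).imp Reach.of_rev Reach.of_rev
    have pos : ∀ {u v : ℕ → ℤ} {a b : ℤ}, Dirs (n + 1) u v → Hooked (n + 1) u v →
        Reach (n + 1) u v a b → 0 < a → 0 < b →
        Reach (n + 1) u v a 0 ∨ Reach (n + 1) u v 0 b := by
      intro u v a b hd hk h ha hb
      by_cases hl : u (n + 1) = 1 ∨ v (n + 1) = 1
      · exact last hd hk hl h ha hb
      by_cases hf : u 0 = 1 ∨ v 0 = 1
      · exact first hd hk hf h ha hb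
      have d0 := hd.dir 0 (by omega)
      have dn := hd.dir (n + 1) le_rfl
      by_cases hv : v 0 = -1
      · exact h.axis_of_first_down hd ha hb hv (by omega)
      · exact (h.swap.axis_of_first_down hd.swap hb ha (by omega) (by omega)).symm.imp
          Reach.swap Reach.swap
    have right : ∀ {u v : ℕ → ℤ} {a b : ℤ}, Dirs (n + 1) u v → Hooked (n + 1) u v →
        Reach (n + 1) u v a b → 0 < a → b ≠ 0 →
        Reach (n + 1) u v a 0 ∨ Reach (n + 1) u v 0 b := by
      intro u v a b hd hk h ha hb
      rcases lt_or_gt_of_ne hb with hb | hb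
      · have := pos hd.swap.neg_left.swap hk.swap.neg_left.swap h.neg_right ha (by omega)
        exact this.imp (fun h => Reach.of_neg_right (by simpa using h)) Reach.of_neg_right
      · exact pos hd hk h ha hb
    rcases lt_or_gt_of_ne ha with ha | ha
    · have := right hd.neg_left hk.neg_left h.neg_left (by omega) hb
      exact this.imp Reach.of_neg_left fun h => Reach.of_neg_left (by simpa using h)
    · exact right hd hk h ha hb

/-! ### From turn sequences to coordinates -/

/-- The horizontal component of the heading after `i` turns. -/
def headX (σ : List Turn) (i : ℕ) : ℤ := (heading (σ.take i)).1

/-- The vertical component of the heading after `i` turns. -/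
def headY (σ : List Turn) (i : ℕ) : ℤ := (heading (σ.take i)).2

theorem heading_concat (τ : List Turn) (t : Turn) :
    heading (τ ++ [t]) = Turn.apply (heading τ) t := by
  simp [heading]

theorem heading_take_succ (σ : List Turn) {i : ℕ} (hi : i < σ.length) :
    heading (σ.take (i + 1)) = Turn.apply (heading (σ.take i)) σ[i] := by
  rw [← heading_concat, List.take_concat_get']

theorem head_succ (σ : List Turn) {i : ℕ} (hi : i < σ.length) :
    (σ[i] = Turn.L ∧ headX σ (i + 1) = -headY σ i ∧ headY σ (i + 1) = headX σ i) ∨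
      (σ[i] = Turn.R ∧ headX σ (i + 1) = headY σ i ∧ headY σ (i + 1) = -headX σ i) := by
  have h := heading_take_succ σ hi
  unfold headX headY
  rw [h]
  cases σ[i]
  · exact .inl ⟨rfl, rfl, rfl⟩
  · exact .inr ⟨rfl, rfl, rfl⟩

theorem headX_zero (σ : List Turn) : headX σ 0 = 1 := by simp [headX, heading]

theorem headY_zero (σ : List Turn) : headY σ 0 = 0 := by simp [headY, heading]

theorem dirs_head (σ : List Turn) : Dirs σ.length (headX σ) (headY σ) := by
  have h : ∀ i ≤ σ.length, (headX σ i = 0 ∧ (headY σ i = 1 ∨ headY σ i = -1)) ∨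
      (headY σ i = 0 ∧ (headX σ i = 1 ∨ headX σ i = -1)) := by
    intro i
    induction i with
    | zero => simp [headX_zero, headY_zero]
    | succ i ih =>
      intro hi
      have h1 := ih (by omega)
      have h2 := head_succ σ (i := i) (by omega)
      omega
  refine ⟨h, fun i hi => ?_⟩
  have h1 := h i hi.le
  have h2 := head_succ σ hi
  omega

theorem mem_seg_iff {C : ℕ → ℤ × ℤ} {i : ℕ}
    (h : (C (i + 1)).1 = (C i).1 ∨ (C (i + 1)).2 = (C i).2) (z : ℝ × ℝ) :
    z ∈ seg C i ↔ z.1 ∈ Set.uIcc ((C i).1 : ℝ) (C (i + 1)).1 ∧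
      z.2 ∈ Set.uIcc ((C i).2 : ℝ) (C (i + 1)).2 := by
  obtain ⟨a, b⟩ := z
  unfold seg toPlane
  rcases h with h | h
  · rw [h, ← Prod.image_mk_segment_right, segment_eq_uIcc]
    simp only [Set.mem_image, Prod.mk.injEq, Set.uIcc_self, Set.mem_singleton_iff]
    constructor
    · rintro ⟨c, hc, rfl, rfl⟩
      exact ⟨rfl, hc⟩
    · rintro ⟨rfl, hb⟩
      exact ⟨b, hb, rfl, rfl⟩
  · rw [h, ← Prod.image_mk_segment_left, segment_eq_uIcc]
    simp only [Set.mem_image, Prod.mk.injEq, Set.uIcc_self, Set.mem_singleton_iff]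
    constructor
    · rintro ⟨c, hc, rfl, rfl⟩
      exact ⟨hc, rfl⟩
    · rintro ⟨ha, rfl⟩
      exact ⟨a, ha, rfl, rfl⟩

theorem cast_mem_uIcc {a p q : ℤ} (h : Btw a p q) : (a : ℝ) ∈ Set.uIcc (p : ℝ) q := by
  rw [Set.mem_uIcc]
  exact_mod_cast h

theorem not_mem_of_separated {p q r s : ℤ} (h : max p q < min r s ∨ max r s < min p q) {z : ℝ}
    (h1 : z ∈ Set.uIcc (p : ℝ) q) (h2 : z ∈ Set.uIcc (r : ℝ) s) : False := by
  rw [Set.mem_uIcc] at h1 h2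
  have h' : max (p : ℝ) q < min (r : ℝ) s ∨ max (r : ℝ) s < min (p : ℝ) q := by exact_mod_cast h
  simp only [max_lt_iff, lt_min_iff] at h'
  rcases h' with h' | h' <;> rcases h1 with h1 | h1 <;> rcases h2 with h2 | h2 <;> linarith

theorem Realizes.gridChain {σ : List Turn} {C : ℕ → ℤ × ℤ} (h : Realizes σ C) :
    GridChain σ.length (headX σ) (headY σ) (fun k => (C k).1) (fun k => (C k).2) := by
  have hd := dirs_head σ
  have hs : ∀ i ≤ σ.length, ∃ l : ℤ, 0 < l ∧ (C (i + 1)).1 = (C i).1 + l * headX σ i ∧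
      (C (i + 1)).2 = (C i).2 + l * headY σ i := by
    intro i hi
    obtain ⟨l, hl, he⟩ := h.step i hi
    refine ⟨l, by exact_mod_cast hl, ?_, ?_⟩
    · rw [he]
      rfl
    · rw [he]
      rfl
  have hX : Steps σ.length (headX σ) (fun k => (C k).1) := by
    intro i hi
    obtain ⟨l, hl, h1, -⟩ := hs i hi
    dsimp only
    rcases hd.dir i hi with ⟨h2, -⟩ | ⟨-, h2 | h2⟩ <;> rw [h2] at h1 <;> omega
  have hY : Steps σ.length (headY σ) (fun k => (C k).2) := by
    intro i hi
    obtain ⟨l, hl, -, h1⟩ := hs i hi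
    dsimp only
    rcases hd.dir i hi with ⟨-, h2 | h2⟩ | ⟨h2, -⟩ <;> rw [h2] at h1 <;> omega
  have hax : ∀ i ≤ σ.length, (C (i + 1)).1 = (C i).1 ∨ (C (i + 1)).2 = (C i).2 := by
    intro i hi
    rcases hd.dir i hi with ⟨h1, -⟩ | ⟨h1, -⟩
    · exact .inl (hX.eq hi h1)
    · exact .inr (hY.eq hi h1)
  refine ⟨hX, hY, fun i j hij hj a b h1 h2 h3 h4 => ?_⟩
  have := (h.simple i j (by omega) hj (a, b)
    ⟨(mem_seg_iff (hax i (by omega)) _).2 ⟨cast_mem_uIcc h1, cast_mem_uIcc h2⟩,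
      (mem_seg_iff (hax j hj) _).2 ⟨cast_mem_uIcc h3, cast_mem_uIcc h4⟩⟩).1
  omega

/-- Segments are boxes with integral corners, so two of them with a common real point have a common
integral point; integral disjointness suffices. -/
theorem GridChain.realizes {σ : List Turn} {x y : ℕ → ℤ}
    (h : GridChain σ.length (headX σ) (headY σ) x y) (hx : x 0 = 0) (hy : y 0 = 0) :
    Realizes σ (fun k => (x k, y k)) := by
  have hd := dirs_head σ
  have hax : ∀ i ≤ σ.length, x (i + 1) = x i ∨ y (i + 1) = y i := by
    intro i hi
    rcases hd.dir i hi with ⟨h1, -⟩ | ⟨h1, -⟩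
    · exact .inl (h.stepX.eq hi h1)
    · exact .inr (h.stepY.eq hi h1)
  refine ⟨by rw [hx, hy], fun i hi => ?_, fun i j hij hj z hz => ?_⟩
  · have h1 := h.stepX i hi
    have h2 := h.stepY i hi
    have h3 := hd.dir i hi
    -- One of the two differences vanishes, so the sum is the length of the segment.
    refine ⟨(x (i + 1) - x i).natAbs + (y (i + 1) - y i).natAbs, by omega, ?_⟩
    change _ = (x i + _ * headX σ i, y i + _ * headY σ i)
    rw [Prod.mk.injEq]
    rcases h3 with ⟨e1, e2 | e2⟩ | ⟨e1, e2 | e2⟩ <;> rw [e1, e2] <;>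
      constructor <;> omega
  · have m1 := (mem_seg_iff (C := fun k => (x k, y k)) (hax i (by omega)) z).1 hz.1
    have m2 := (mem_seg_iff (C := fun k => (x k, y k)) (hax j hj) z).1 hz.2
    dsimp only at m1 m2
    rcases Nat.lt_or_ge (i + 1) j with hlt | hge
    · exfalso
      by_cases hex : ∃ a, Btw a (x i) (x (i + 1)) ∧ Btw a (x j) (x (j + 1))
      · obtain ⟨a, h1, h2⟩ := hex
        exact not_mem_of_separated
          (separated_of_disjoint fun b h3 h4 => h.apart i j hlt hj a b h1 h3 h2 h4) m1.2 m2.2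
      · exact not_mem_of_separated
          (separated_of_disjoint fun a h3 h4 => hex ⟨a, h3, h4⟩) m1.1 m2.1
    · obtain rfl : j = i + 1 := by omega
      refine ⟨rfl, ?_⟩
      have key : ∀ {p q : ℤ} {r : ℝ}, p = q → r ∈ Set.uIcc (p : ℝ) q → r = p := by
        rintro p q r rfl hr
        simpa using hr
      by_cases hu : headX σ i = 0
      · have e1 := h.stepX.eq (by omega) hu
        have e2 := h.stepY.eq hj ((hd.alt i (by omega)).1 hu)
        refine Prod.ext ?_ (key e2.symm m2.2)
        rw [key e1.symm m1.1, ← e1]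
        rfl
      · have hv : headY σ i = 0 := by
          have := hd.dir i (by omega)
          omega
        have e1 := h.stepY.eq (by omega) hv
        have e2 := h.stepX.eq hj ((hd.swap.alt i (by omega)).1 hv)
        refine Prod.ext (key e2.symm m2.1) ?_
        rw [key e1.symm m1.2, ← e1]
        rfl

theorem mem_reachable_iff (σ : List Turn) (p : ℤ × ℤ) :
    p ∈ reachable σ ↔ Reach σ.length (headX σ) (headY σ) p.1 p.2 := by
  constructor
  · rintro ⟨C, hC, rfl⟩
    have := hC.start
    exact ⟨_, _, hC.gridChain, by simp [this], by simp [this], rfl, rfl⟩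
  · rintro ⟨x, y, hC, h1, h2, h3, h4⟩
    exact ⟨_, hC.realizes h1 h2, Prod.ext h3 h4⟩

/-- Two consecutive turns are equal exactly if they reverse the heading. -/
theorem hasHook_iff (σ : List Turn) (d : ℤ × ℤ) :
    HasHook σ d ↔ ∃ i, i + 2 ≤ σ.length ∧ headX σ i = -headX σ (i + 2) ∧
      headY σ i = -headY σ (i + 2) ∧ headX σ (i + 1) = d.1 ∧ headY σ (i + 1) = d.2 := by
  constructor
  · rintro ⟨τ, ρ, t, rfl, rfl⟩
    have hlen : τ.length + 2 ≤ (τ ++ t :: t :: ρ).length := by simp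
    have h1 := head_succ (τ ++ t :: t :: ρ) (i := τ.length) (by omega)
    have h2 := head_succ (τ ++ t :: t :: ρ) (i := τ.length + 1) (by omega)
    have e1 : (τ ++ t :: t :: ρ)[τ.length] = t := by simp
    have e2 : (τ ++ t :: t :: ρ)[τ.length + 1] = t := by simp
    rw [e1] at h1
    rw [e2, show τ.length + 1 + 1 = τ.length + 2 from rfl] at h2
    have e3 : (τ ++ t :: t :: ρ).take (τ.length + 1) = τ ++ [t] := by
      simp [List.take_append]
    refine ⟨τ.length, hlen, ?_, ?_, ?_, ?_⟩
    · rcases h1 with ⟨rfl, h1⟩ | ⟨rfl, h1⟩ <;> simp only [reduceCtorEq, true_and, false_and, or_false,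
        false_or] at h2 <;> omega
    · rcases h1 with ⟨rfl, h1⟩ | ⟨rfl, h1⟩ <;> simp only [reduceCtorEq, true_and, false_and, or_false,
        false_or] at h2 <;> omega
    · rw [headX, e3]
    · rw [headY, e3]
  · rintro ⟨i, hi, h1, h2, h3, h4⟩
    have s1 := head_succ σ (i := i) (by omega)
    have s2 := head_succ σ (i := i + 1) (by omega)
    have hd := (dirs_head σ).dir i (by omega)
    have heq : σ[i] = σ[i + 1] := by
      rcases s1 with ⟨t1, s1⟩ | ⟨t1, s1⟩ <;> rcases s2 with ⟨t2, s2⟩ | ⟨t2, s2⟩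
      · rw [t1, t2]
      · rw [show i + 1 + 1 = i + 2 from rfl] at s2
        omega
      · rw [show i + 1 + 1 = i + 2 from rfl] at s2
        omega
      · rw [t1, t2]
    refine ⟨σ.take i, σ.drop (i + 2), σ[i], ?_, ?_⟩
    · conv_lhs => rw [← List.take_append_drop i σ]
      rw [List.drop_eq_getElem_cons (show i < σ.length by omega),
        List.drop_eq_getElem_cons (show i + 1 < σ.length by omega), ← heq]
    · rw [List.take_concat_get']
      exact Prod.ext h3 h4

theorem isStaircase_iff (σ : List Turn) :
    IsStaircase σ ↔ ¬ Hooked σ.length (headX σ) (headY σ) := by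
  rw [IsStaircase, List.isChain_iff_getElem]
  constructor
  · rintro h ⟨i, hi, h1, h2⟩
    obtain ⟨τ, ρ, t, rfl, -⟩ := (hasHook_iff σ (headX σ (i + 1), headY σ (i + 1))).2
      ⟨i, hi, h1, h2, rfl, rfl⟩
    have := h τ.length (by simp)
    simp at this
  · intro h i hi heq
    refine h ⟨i, by omega, ?_⟩
    have s1 := head_succ σ (i := i) (by omega)
    have s2 := head_succ σ (i := i + 1) (by omega)
    rw [← heq] at s2
    rcases s1 with ⟨t1, s1⟩ | ⟨t1, s1⟩ <;> rw [t1] at s2 <;> simp only [reduceCtorEq, true_and,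
      false_and, or_false, false_or, show i + 1 + 1 = i + 2 from rfl] at s2 <;> omega

/-! ### Half-planes, quadrants and staircases -/

theorem mem_VPlus_of_pos {p q : ℤ × ℤ} (h : 0 < p.1) : q ∈ VPlus p ↔ p.1 ≤ q.1 := by
  simp only [VPlus, Set.mem_ofPred_eq, Int.sign_eq_one_of_pos h, one_mul]
  constructor
  · rintro ⟨i, j, rfl⟩
    simp
  · intro hq
    exact ⟨(q.1 - p.1).toNat, q.2, Prod.ext (by dsimp only; omega) rfl⟩

theorem mem_VPlus_of_neg {p q : ℤ × ℤ} (h : p.1 < 0) : q ∈ VPlus p ↔ q.1 ≤ p.1 := by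
  simp only [VPlus, Set.mem_ofPred_eq, Int.sign_eq_neg_one_of_neg h]
  constructor
  · rintro ⟨i, j, rfl⟩
    dsimp only
    omega
  · intro hq
    exact ⟨(p.1 - q.1).toNat, q.2, Prod.ext (by dsimp only; omega) rfl⟩

theorem mem_HPlus_of_pos {p q : ℤ × ℤ} (h : 0 < p.2) : q ∈ HPlus p ↔ p.2 ≤ q.2 := by
  simp only [HPlus, Set.mem_ofPred_eq, Int.sign_eq_one_of_pos h, one_mul]
  constructor
  · rintro ⟨i, j, rfl⟩
    simp
  · intro hq
    exact ⟨q.1, (q.2 - p.2).toNat, Prod.ext rfl (by dsimp only; omega)⟩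

theorem mem_HPlus_of_neg {p q : ℤ × ℤ} (h : p.2 < 0) : q ∈ HPlus p ↔ q.2 ≤ p.2 := by
  simp only [HPlus, Set.mem_ofPred_eq, Int.sign_eq_neg_one_of_neg h]
  constructor
  · rintro ⟨i, j, rfl⟩
    dsimp only
    omega
  · intro hq
    exact ⟨q.1, (p.2 - q.2).toNat, Prod.ext rfl (by dsimp only; omega)⟩

theorem exists_isLeast_of_pos {P : ℤ → Prop} {c : ℤ} (hc : 0 < c) (h : P c) :
    ∃ a, IsLeast {c : ℤ | 0 < c ∧ P c} a := by
  obtain ⟨a, h1, h2⟩ := Int.exists_least_of_bdd (P := fun c => 0 < c ∧ P c)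
    ⟨0, fun z hz => hz.1.le⟩ ⟨c, hc, h⟩
  exact ⟨a, h1, fun z hz => h2 z hz⟩

theorem exists_isGreatest_of_neg {P : ℤ → Prop} {c : ℤ} (hc : c < 0) (h : P c) :
    ∃ a, IsGreatest {c : ℤ | c < 0 ∧ P c} a := by
  obtain ⟨a, h1, h2⟩ := Int.exists_greatest_of_bdd (P := fun c => c < 0 ∧ P c)
    ⟨0, fun z hz => hz.1.le⟩ ⟨c, hc, h⟩
  exact ⟨a, h1, fun z hz => h2 z hz⟩

/-- A reachable point on the x-axis yields a half-plane of reachable points. -/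
theorem Reach.halfplane_of_pos {n : ℕ} {u v : ℕ → ℤ} (hd : Dirs n u v) (hn : 1 ≤ n) {a a' : ℤ}
    (h : Reach n u v a 0) (ha : 0 < a) (haa : a ≤ a') (b : ℤ) : Reach n u v a' b :=
  (h.swap.stretch_right ha haa).swap.of_axis hd hn b

theorem Reach.halfplane_of_neg {n : ℕ} {u v : ℕ → ℤ} (hd : Dirs n u v) (hn : 1 ≤ n) {a a' : ℤ}
    (h : Reach n u v a 0) (ha : a < 0) (haa : a' ≤ a) (b : ℤ) : Reach n u v a' b :=
  (h.neg_left.halfplane_of_pos hd.neg_left hn (by omega) (neg_le_neg haa) b).of_neg_left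

/-- The points reachable by a staircase that heads to the east and to the north. -/
theorem reach_staircase_iff {n : ℕ} {u v : ℕ → ℤ} (hd : Dirs n u v) (hn : 1 ≤ n)
    (hk : ¬ Hooked n u v) (h0 : u 0 = 1) (h1 : v 1 = 1) (a b : ℤ) :
    Reach n u v a b ↔ ((n / 2 : ℕ) : ℤ) + 1 ≤ a ∧ (((n + 1) / 2 : ℕ) : ℤ) ≤ b := by
  have hdir : ∀ i ≤ n, (i % 2 = 0 → u i = 1 ∧ v i = 0) ∧ (i % 2 = 1 → u i = 0 ∧ v i = 1) := by
    intro i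
    induction i using Nat.strong_induction_on with
    | _ i ih =>
      intro hi
      have d0 := hd.dir i hi
      rcases Nat.lt_or_ge i 2 with hlt | hge
      · have : i = 0 ∨ i = 1 := by omega
        rcases this with rfl | rfl <;> omega
      · obtain ⟨j, rfl⟩ : ∃ j, i = j + 2 := ⟨i - 2, by omega⟩
        have hj := ih j (by omega) (by omega)
        have a0 := hd.alt j (by omega)
        have a1 := hd.alt (j + 1) (by omega)
        have d1 := hd.dir (j + 1) (by omega)
        rw [show j + 1 + 1 = j + 2 from rfl] at a1
        have hne : ¬ (u j = -u (j + 2) ∧ v j = -v (j + 2)) := fun h => hk ⟨j, hi, h.1, h.2⟩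
        omega
  constructor
  · rintro ⟨x, y, hC, e1, e2, rfl, rfl⟩
    have : ∀ k ≤ n + 1, (((k + 1) / 2 : ℕ) : ℤ) ≤ x k ∧ ((k / 2 : ℕ) : ℤ) ≤ y k := by
      intro k
      induction k with
      | zero => simp [e1, e2]
      | succ k ih =>
        intro hk
        have i1 := ih (by omega)
        have s1 := hC.stepX k (by omega)
        have s2 := hC.stepY k (by omega)
        have d := hdir k (by omega)
        omega
    have := this (n + 1) le_rfl
    omega
  · rintro ⟨ha, hb⟩
    -- The unit staircase attains both lower bounds at once; stretching along each axis reaches the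
    -- remaining points.
    have base : Reach n u v (((n + 2) / 2 : ℕ) : ℤ) (((n + 1) / 2 : ℕ) : ℤ) := by
      refine ⟨fun k => (((k + 1) / 2 : ℕ) : ℤ), fun k => ((k / 2 : ℕ) : ℤ), ⟨fun i hi => ?_,
        fun i hi => ?_, fun i j hij hj a b c1 c2 c3 c4 => ?_⟩, by simp, by simp, rfl, rfl⟩
      · have d := hdir i hi
        omega
      · have d := hdir i hi
        omega
      · omega
    exact ((base.stretch_right (by omega) hb).swap.stretch_right (by omega)
      (show _ ≤ a by omega)).swap

theorem floor_half (n : ℕ) : ⌊(n : ℚ) / 2⌋ = ((n / 2 : ℕ) : ℤ) := by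
  rw [Int.floor_eq_iff]
  obtain ⟨k, rfl | rfl⟩ := n.even_or_odd'
  · rw [Nat.mul_div_cancel_left _ two_pos]
    push_cast
    constructor <;> linarith
  · rw [show (2 * k + 1) / 2 = k by omega]
    push_cast
    constructor <;> linarith

theorem ceil_half (n : ℕ) : ⌈(n : ℚ) / 2⌉ = (((n + 1) / 2 : ℕ) : ℤ) := by
  rw [Int.ceil_eq_iff]
  obtain ⟨k, rfl | rfl⟩ := n.even_or_odd'
  · rw [show (2 * k + 1) / 2 = k by omega]
    push_cast
    constructor <;> linarith
  · rw [show (2 * k + 1 + 1) / 2 = k + 1 by omega]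
    push_cast
    constructor <;> linarith

/-! ### The cases of the theorem -/

/-- Reachable points on the positive x-axis correspond to right hooks. -/
theorem exists_reach_iff_hook {n : ℕ} {u v : ℕ → ℤ} (hd : Dirs n u v) (hn : 1 ≤ n) :
    (∃ a, 0 < a ∧ Reach n u v a 0) ↔ ∃ i, i + 2 ≤ n ∧ u i = -u (i + 2) ∧ v i = -v (i + 2) ∧
      u (i + 1) = 1 ∧ v (i + 1) = 0 := by
  constructor
  · rintro ⟨a, ha, h⟩
    obtain ⟨i, hi, h1, h2⟩ := exists_hook_of_reach hd hn ha h
    have d1 := hd.dir (i + 1) (by omega)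
    have a0 := hd.alt_left (i := i) (by omega)
    have a1 := hd.alt_left (i := i + 1) (by omega)
    rw [show i + 1 + 1 = i + 2 from rfl] at a1
    exact ⟨i, hi, by omega, h1, h2, by omega⟩
  · rintro ⟨i, hi, -, h1, h2, -⟩
    exact exists_reach_of_hook hd hi h1 h2

theorem exists_isXPlus_iff {σ : List Turn} (hn : 1 ≤ σ.length) :
    (∃ a, IsXPlus σ a) ↔ HasRightHook σ := by
  rw [HasRightHook, hasHook_iff, ← exists_reach_iff_hook (dirs_head σ) hn]
  constructor
  · rintro ⟨a, ha⟩
    exact ⟨a, ha.1.1, (mem_reachable_iff σ _).1 ha.1.2⟩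
  · rintro ⟨a, ha, h⟩
    exact exists_isLeast_of_pos ha ((mem_reachable_iff σ (a, 0)).2 h)

theorem exists_isXMinus_iff {σ : List Turn} (hn : 1 ≤ σ.length) :
    (∃ a, IsXMinus σ a) ↔ HasLeftHook σ := by
  have h : (∃ a, IsXMinus σ a) ↔
      ∃ a, 0 < a ∧ Reach σ.length (fun i => -headX σ i) (headY σ) a 0 := by
    constructor
    · rintro ⟨a, ha⟩
      exact ⟨-a, by have := ha.1.1; omega, ((mem_reachable_iff σ _).1 ha.1.2).neg_left⟩
    · rintro ⟨a, ha, h⟩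
      refine exists_isGreatest_of_neg (c := -a) (by omega) ((mem_reachable_iff σ (-a, 0)).2 ?_)
      exact Reach.of_neg_left (by simpa using h)
  rw [h, HasLeftHook, hasHook_iff, exists_reach_iff_hook (dirs_head σ).neg_left hn]
  refine exists_congr fun i => and_congr_right fun _ => ?_
  dsimp only
  omega

theorem exists_isYPlus_iff {σ : List Turn} (hn : 1 ≤ σ.length) :
    (∃ b, IsYPlus σ b) ↔ HasUpHook σ := by
  have h : (∃ b, IsYPlus σ b) ↔ ∃ b, 0 < b ∧ Reach σ.length (headY σ) (headX σ) b 0 := by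
    constructor
    · rintro ⟨b, hb⟩
      exact ⟨b, hb.1.1, ((mem_reachable_iff σ _).1 hb.1.2).swap⟩
    · rintro ⟨b, hb, h⟩
      exact exists_isLeast_of_pos hb ((mem_reachable_iff σ (0, b)).2 h.swap)
  rw [h, HasUpHook, hasHook_iff, exists_reach_iff_hook (dirs_head σ).swap hn]
  refine exists_congr fun i => and_congr_right fun _ => ?_
  dsimp only
  omega

theorem exists_isYMinus_iff {σ : List Turn} (hn : 1 ≤ σ.length) :
    (∃ b, IsYMinus σ b) ↔ HasDownHook σ := by
  have h : (∃ b, IsYMinus σ b) ↔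
      ∃ b, 0 < b ∧ Reach σ.length (fun i => -headY σ i) (headX σ) b 0 := by
    constructor
    · rintro ⟨b, hb⟩
      exact ⟨-b, by have := hb.1.1; omega, ((mem_reachable_iff σ _).1 hb.1.2).swap.neg_left⟩
    · rintro ⟨b, hb, h⟩
      refine exists_isGreatest_of_neg (c := -b) (by omega) ((mem_reachable_iff σ (0, -b)).2 ?_)
      exact (Reach.of_neg_left (by simpa using h)).swap
  rw [h, HasDownHook, hasHook_iff, exists_reach_iff_hook (dirs_head σ).swap.neg_left hn]
  refine exists_congr fun i => and_congr_right fun _ => ?_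
  dsimp only
  omega

theorem reachable_of_length_eq_zero {σ : List Turn} (h : σ.length = 0) :
    reachable σ = {p : ℤ × ℤ | ∃ a : ℤ, 1 ≤ a ∧ p = (a, 0)} := by
  have hu := headX_zero σ
  have hv := headY_zero σ
  ext ⟨a, b⟩
  rw [mem_reachable_iff, h]
  constructor
  · rintro ⟨x, y, hC, h1, h2, h3, h4⟩
    have s1 := hC.stepX 0 le_rfl
    have s2 := hC.stepY.eq le_rfl hv
    exact ⟨a, by dsimp only at h3; omega, Prod.ext rfl (by dsimp only at h4 ⊢; omega)⟩
  · rintro ⟨c, hc, he⟩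
    obtain ⟨rfl, rfl⟩ := Prod.mk.inj he
    refine ⟨fun k => if k = 0 then 0 else a, fun _ => 0, ⟨fun i hi => ?_, fun i hi => ?_,
      fun i j hij hj => by omega⟩, by simp, by simp, by simp, rfl⟩
    · obtain rfl : i = 0 := by omega
      right; left
      simp [hu]
      omega
    · obtain rfl : i = 0 := by omega
      exact .inl ⟨hv, rfl⟩

theorem reachable_of_left_staircase {σ : List Turn} (hs : IsStaircase σ)
    (hL : σ.head? = some Turn.L) :
    reachable σ = QPlus (1 + ⌊(σ.length : ℚ) / 2⌋, ⌈(σ.length : ℚ) / 2⌉) := by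
  rw [isStaircase_iff] at hs
  obtain ⟨τ, rfl⟩ := List.head?_eq_some_iff.1 hL
  have h1 := head_succ (Turn.L :: τ) (i := 0) (by simp)
  simp only [List.getElem_cons_zero, true_and, reduceCtorEq, false_and, or_false, zero_add,
    headX_zero] at h1
  have hn : 1 ≤ (Turn.L :: τ).length := by simp
  ext ⟨a, b⟩
  rw [mem_reachable_iff, reach_staircase_iff (dirs_head _) hn hs (headX_zero _) h1.2, QPlus,
    Set.mem_inter_iff, mem_VPlus_of_pos, mem_HPlus_of_pos, floor_half, ceil_half]
  · rw [add_comm]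
  · rw [ceil_half]
    dsimp only
    omega
  · rw [floor_half]
    dsimp only
    omega

theorem reachable_of_right_staircase {σ : List Turn} (hs : IsStaircase σ)
    (hR : σ.head? = some Turn.R) :
    reachable σ = QPlus (1 + ⌊(σ.length : ℚ) / 2⌋, -⌈(σ.length : ℚ) / 2⌉) := by
  rw [isStaircase_iff] at hs
  obtain ⟨τ, rfl⟩ := List.head?_eq_some_iff.1 hR
  have h1 := head_succ (Turn.R :: τ) (i := 0) (by simp)
  simp only [List.getElem_cons_zero, true_and, reduceCtorEq, false_and, false_or, zero_add,
    headX_zero] at h1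
  have hn : 1 ≤ (Turn.R :: τ).length := by simp
  have hs' : ¬ Hooked (Turn.R :: τ).length (headX (Turn.R :: τ))
      (fun i => -headY (Turn.R :: τ) i) := fun h => hs (by simpa using h.swap.neg_left.swap)
  ext ⟨a, b⟩
  have hneg : Reach (Turn.R :: τ).length (headX (Turn.R :: τ)) (headY (Turn.R :: τ)) a b ↔
      Reach (Turn.R :: τ).length (headX (Turn.R :: τ)) (fun i => -headY (Turn.R :: τ) i) a (-b) :=
    ⟨Reach.neg_right, Reach.of_neg_right⟩
  rw [mem_reachable_iff, hneg, reach_staircase_iff (dirs_head _).swap.neg_left.swap hn hs'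
    (headX_zero _) (by omega), QPlus, Set.mem_inter_iff, mem_VPlus_of_pos, mem_HPlus_of_neg,
    floor_half, ceil_half]
  · rw [add_comm, le_neg]
  · rw [ceil_half]
    dsimp only
    omega
  · rw [floor_half]
    dsimp only
    omega

/-- Projection puts each reachable point level with a reachable axis point, which is at least as far
out as the nearest one on its half-axis. Conversely, the nearest point spreads to its whole
half-plane. -/
theorem reachable_of_not_staircase {σ : List Turn} (hs : ¬ IsStaircase σ) :
    reachable σ =
      (⋃ a ∈ {a : ℤ | IsXPlus σ a ∨ IsXMinus σ a}, VPlus (a, 0)) ∪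
      (⋃ b ∈ {b : ℤ | IsYPlus σ b ∨ IsYMinus σ b}, HPlus (0, b)) := by
  rw [isStaircase_iff, not_not] at hs
  have hd := dirs_head σ
  have hn : 1 ≤ σ.length := by
    obtain ⟨i, hi, -⟩ := hs
    omega
  -- An end at the origin would lie on segment 0, which would then be the last one.
  have hne : ¬ Reach σ.length (headX σ) (headY σ) 0 0 := by
    rintro ⟨x, y, hC, h1, h2, h3, h4⟩
    have := hC.eq_of_end hd (Nat.zero_le _) (by omega) (by omega)
    omega
  ext ⟨a, b⟩
  simp only [Set.mem_union, Set.mem_iUnion, Set.mem_ofPred_eq, exists_prop]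
  constructor
  · intro h
    rw [mem_reachable_iff] at h
    have hax : Reach σ.length (headX σ) (headY σ) a 0 ∨ Reach σ.length (headX σ) (headY σ) 0 b := by
      by_cases ha : a = 0
      · subst ha
        exact .inr h
      · by_cases hb : b = 0
        · subst hb
          exact .inl h
        · exact h.axis hd hs ha hb
    rcases hax with h | h
    · left
      rcases lt_trichotomy a 0 with ha | rfl | ha
      · have hm : (a, 0) ∈ reachable σ := (mem_reachable_iff σ (a, 0)).2 h
        obtain ⟨c, hc⟩ : ∃ c, IsXMinus σ c := exists_isGreatest_of_neg ha hm
        exact ⟨c, .inr hc, (mem_VPlus_of_neg hc.1.1).2 (hc.2 ⟨ha, hm⟩)⟩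
      · exact (hne h).elim
      · have hm : (a, 0) ∈ reachable σ := (mem_reachable_iff σ (a, 0)).2 h
        obtain ⟨c, hc⟩ : ∃ c, IsXPlus σ c := exists_isLeast_of_pos ha hm
        exact ⟨c, .inl hc, (mem_VPlus_of_pos hc.1.1).2 (hc.2 ⟨ha, hm⟩)⟩
    · right
      rcases lt_trichotomy b 0 with hb | rfl | hb
      · have hm : (0, b) ∈ reachable σ := (mem_reachable_iff σ (0, b)).2 h
        obtain ⟨c, hc⟩ : ∃ c, IsYMinus σ c := exists_isGreatest_of_neg hb hm
        exact ⟨c, .inr hc, (mem_HPlus_of_neg hc.1.1).2 (hc.2 ⟨hb, hm⟩)⟩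
      · exact (hne h).elim
      · have hm : (0, b) ∈ reachable σ := (mem_reachable_iff σ (0, b)).2 h
        obtain ⟨c, hc⟩ : ∃ c, IsYPlus σ c := exists_isLeast_of_pos hb hm
        exact ⟨c, .inl hc, (mem_HPlus_of_pos hc.1.1).2 (hc.2 ⟨hb, hm⟩)⟩
  · rw [mem_reachable_iff]
    rintro (⟨c, hc | hc, hm⟩ | ⟨c, hc | hc, hm⟩)
    · have hr := (mem_reachable_iff σ _).1 hc.1.2
      exact hr.halfplane_of_pos hd hn hc.1.1 ((mem_VPlus_of_pos hc.1.1).1 hm) b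
    · have hr := (mem_reachable_iff σ _).1 hc.1.2
      exact hr.halfplane_of_neg hd hn hc.1.1 ((mem_VPlus_of_neg hc.1.1).1 hm) b
    · have hr := (mem_reachable_iff σ _).1 hc.1.2
      exact (hr.swap.halfplane_of_pos hd.swap hn hc.1.1 ((mem_HPlus_of_pos hc.1.1).1 hm) a).swap
    · have hr := (mem_reachable_iff σ _).1 hc.1.2
      exact (hr.swap.halfplane_of_neg hd.swap hn hc.1.1 ((mem_HPlus_of_neg hc.1.1).1 hm) a).swap

end TurnSeq

theorem theorem1 (σ : List Turn) :
    (σ.length = 0 → reachable σ = {p : ℤ × ℤ | ∃ a : ℤ, 1 ≤ a ∧ p = (a, 0)}) ∧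
    (IsStaircase σ → σ.head? = some Turn.L →
      reachable σ = QPlus (1 + ⌊(σ.length : ℚ) / 2⌋, ⌈(σ.length : ℚ) / 2⌉)) ∧
    (IsStaircase σ → σ.head? = some Turn.R →
      reachable σ = QPlus (1 + ⌊(σ.length : ℚ) / 2⌋, -⌈(σ.length : ℚ) / 2⌉)) ∧
    (¬ IsStaircase σ →
      reachable σ =
        (⋃ a ∈ {a : ℤ | IsXPlus σ a ∨ IsXMinus σ a}, VPlus (a, 0)) ∪
        (⋃ b ∈ {b : ℤ | IsYPlus σ b ∨ IsYMinus σ b}, HPlus (0, b))) ∧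
    (σ.length ≠ 0 →
      ((∃ a, IsXPlus σ a) ↔ HasRightHook σ) ∧
      ((∃ a, IsXMinus σ a) ↔ HasLeftHook σ) ∧
      ((∃ b, IsYPlus σ b) ↔ HasUpHook σ) ∧
      ((∃ b, IsYMinus σ b) ↔ HasDownHook σ)) := by
  refine ⟨reachable_of_length_eq_zero, reachable_of_left_staircase, reachable_of_right_staircase,
    reachable_of_not_staircase, fun h => ?_⟩
  have hn : 1 ≤ σ.length := Nat.one_le_iff_ne_zero.2 h
  exact ⟨exists_isXPlus_iff hn, exists_isXMinus_iff hn, exists_isYPlus_iff hn,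
    exists_isYMinus_iff hn⟩
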